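/- Let $S$ be either a smooth affine curve over $\mathbb{C}$ or an open disc in $\mathbb{C}$ with its sheaf $\mathcal{O}_S$ of holomorphic functions, and let $x\in S$ be a (closed) point. Let $\mathcal{L}$ be the sheaf of $\mathbb{C}$-linear differential operators on $\mathcal{O}_S$ of order $\le 1$ whose symbol is a vector field vanishing at $x$. It is an $\mathcal{O}_S$-bimodule, by $(a\cdot v)(f)=a\,v(f)$ and $(v\cdot a)(f)=v(af)$, and it contains $\mathcal{O}_S$ as the operators of order $0$. The vector field $t\,\partial/\partial t$, where $t$ is a coordinate at $x$, defines an element $(t\,\partial/\partial t)_x$ of the fibre $\mathcal{L}_x$ which does not depend on $t$. Let $F$ be a bounded complex of vector bundles (locally free $\mathcal{O}_S$-modules of finite rank) on $S$, and let $$M:\mathcal{L}\otimes_{\mathcal{O}_S}F\to F$$ be a morphism of complexes of $\mathcal{O}_S$-modules, where the tensor product uses the right module structure of $\mathcal{L}$ and $\mathcal{L}\otimes_{\mathcal{O}_S} F$ is an $\mathcal{O}_S$-module through the left module structure of $\mathcal{L}$. Let $M_0:F\to F$ be the restriction of $M$ to $\mathcal{O}_S\subset\mathcal{L}$. Since the symbols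 of elements of $\mathcal{L}$ vanish at $x$, $M$ induces a morphism $M_x:\mathcal{L}_x\otimes F_x\to F_x$ on the fibres at $x$, where $F_x=F\otimes k(x)$. Suppose that 1. $M_0$ induces the identity on the cohomology sheaves $\mathcal{H}^i(F)$ and on the cohomology spaces $H^i(F_x)$, for all $i$; 2. the endomorphism of $H^i(F_x)$ induced by $M_x$ and $(t\,\partial/\partial t)_x$ is nilpotent, for all $i$. Then there is an open neighbourhood $U$ of $x$ such that the cohomology sheaves of $F|_U$ are free of finite rank and $F|_U$ is homotopy equivalent to the direct sum $\bigoplus_i \mathcal{H}^i(F|_U)[-i]$ of its cohomology sheaves. -/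

import Mathlib

open CategoryTheory AlgebraicGeometry TopologicalSpace Opposite Manifold
open scoped ContDiff

/-- A locally ringed space together with a ring homomorphism from `ℂ` to its global functions
(the constants); this turns its structure sheaf into a sheaf of `ℂ`-algebras. -/
structure CSpace where
  /-- the locally ringed space -/
  X : LocallyRingedSpace.{0}
  /-- the constant functions -/
  const : ℂ →+* X.presheaf.obj (op ⊤)

noncomputable section

namespace CSpace

/-! ### Affine curves and discs -/

/-- The `ℂ`-space underlying a scheme over `Spec ℂ`. -/
def ofScheme {Y : Scheme.{0}} (f : Y ⟶ Spec (CommRingCat.of ℂ)) : CSpace where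
  X := Y.toLocallyRingedSpace
  const := ((Scheme.ΓSpecIso (CommRingCat.of ℂ)).inv ≫ f.appTop).hom

/-- The open disc with centre `c` and radius `r` in `ℂ`, with its sheaf of holomorphic functions
(functions that are smooth over the field `ℂ`). -/
def disc (c : ℂ) (r : ℝ) : CSpace where
  X := ChartedSpace.locallyRingedSpace 𝓘(ℂ) (⟨Metric.ball c r, Metric.isOpen_ball⟩ : Opens ℂ)
  const := algebraMap ℂ
    C^∞⟮𝓘(ℂ), (⊤ : Opens (⟨Metric.ball c r, Metric.isOpen_ball⟩ : Opens ℂ)); 𝓘(ℂ), ℂ⟯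

/-- `S` is a smooth affine curve over `ℂ`. -/
def IsAffineCurve (S : CSpace) : Prop :=
  ∃ (Y : Scheme.{0}) (f : Y ⟶ Spec (CommRingCat.of ℂ)),
    IsAffine Y ∧ SmoothOfRelativeDimension 1 f ∧ S = ofScheme f

/-- `S` is an open disc in the complex plane, with its sheaf of holomorphic functions. -/
def IsDisc (S : CSpace) : Prop := ∃ (c : ℂ) (r : ℝ), S = disc c r

variable (S : CSpace)

/-! ### The structure sheaf and its modules -/

/-- The underlying topological space. -/
abbrev Pt : TopCat.{0} := S.X.toTopCat

/-- The ring `𝒪(U)` of functions on `U`. -/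
abbrev O (U : Opens S.Pt) : CommRingCat.{0} := S.X.presheaf.obj (op U)

/-- The local ring `𝒪_x`. -/
abbrev Ox (x : S.Pt) : CommRingCat.{0} := S.X.presheaf.stalk x

/-- The residue field `k(x) = 𝒪_x / 𝔪_x`. -/
abbrev kx (x : S.Pt) : Type := S.Ox x ⧸ IsLocalRing.maximalIdeal (S.Ox x)

/-- The germ at `x` of a function. -/
abbrev germ {U : Opens S.Pt} {x : S.Pt} (hx : x ∈ U) : S.O U →+* S.Ox x :=
  (S.X.presheaf.germ U x hx).hom

/-- Restriction of functions. -/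
abbrev res {V U : Opens S.Pt} (h : V ≤ U) : S.O U →+* S.O V :=
  (S.X.presheaf.map (homOfLE h).op).hom

/-- The constant function on `U` with value `c`. -/
def cst (U : Opens S.Pt) (c : ℂ) : S.O U := S.res le_top (S.const c)

/-- The structure sheaf as a sheaf of rings. -/
abbrev ringSheaf : TopCat.Sheaf RingCat.{0} S.Pt :=
  (sheafCompose _ (forget₂ CommRingCat RingCat)).obj S.X.sheaf

/-- Sheaves of `𝒪`-modules. -/
abbrev Mods := SheafOfModules.{0} S.ringSheaf

/-- Sheaves of `𝒪`-modules over the open subset `U`. -/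
abbrev ModsOver (U : Opens S.Pt) := SheafOfModules.{0} (S.ringSheaf.over U)

variable {S}

/-- Sections over `U` of a sheaf of modules. -/
abbrev Sec (M : S.Mods) (U : Opens S.Pt) : Type := M.val.obj (op U)

instance (M : S.Mods) (U : Opens S.Pt) : Module (S.O U) (Sec M U) := (M.val.obj (op U)).isModule

/-- Restriction of sections. -/
abbrev rs (M : S.Mods) {V U : Opens S.Pt} (h : V ≤ U) : Sec M U →+ Sec M V :=
  (M.val.presheaf.map (homOfLE h).op).hom

/-- The action of a morphism of sheaves of modules on sections. -/
def mapSec {M N : S.Mods} (φ : M ⟶ N) (U : Opens S.Pt) : Sec M U →ₗ[S.O U] Sec N U :=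
  (φ.val.app (op U)).hom

/-- The stalk of a sheaf of modules. -/
abbrev stalk (M : S.Mods) (x : S.Pt) : Type :=
  ↑(TopCat.Presheaf.stalk (C := Ab) (X := S.Pt) M.val.presheaf x)

instance (M : S.Mods) (x : S.Pt) : Module (S.Ox x) (stalk M x) :=
  let N : PresheafOfModules.{0} (S.X.presheaf ⋙ forget₂ CommRingCat RingCat) := M.val
  inferInstanceAs (Module (S.X.presheaf.stalk x)
    (TopCat.Presheaf.stalk (C := Ab) (X := S.Pt) N.presheaf x))

/-- The germ at `x` of a section. -/
abbrev mgerm (M : S.Mods) {U : Opens S.Pt} {x : S.Pt} (hx : x ∈ U) : Sec M U →+ stalk M x :=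
  (TopCat.Presheaf.germ (C := Ab) (X := S.Pt) M.val.presheaf U x hx).hom

lemma mgerm_smul (M : S.Mods) {U : Opens S.Pt} {x : S.Pt} (hx : x ∈ U) (a : S.O U) (m : Sec M U) :
    mgerm M hx (a • m) = S.germ hx a • mgerm M hx m :=
  PresheafOfModules.germ_smul (R := S.X.presheaf) M.val x U hx a m

lemma mgerm_res (M : S.Mods) {V U : Opens S.Pt} (h : V ≤ U) {x : S.Pt} (hx : x ∈ V) (m : Sec M U) :
    mgerm M hx (rs M h m) = mgerm M (h hx) m :=
  TopCat.Presheaf.germ_res_apply (C := Ab) (X := S.Pt) M.val.presheaf (homOfLE h) x hx m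

lemma exists_mgerm (M : S.Mods) {x : S.Pt} (s : stalk M x) :
    ∃ (U : Opens S.Pt) (hx : x ∈ U) (m : Sec M U), mgerm M hx m = s :=
  TopCat.Presheaf.exists_germ_eq (C := Ab) (X := S.Pt) M.val.presheaf s

/-! ### Fibres -/

/-- The submodule `𝔪_x M_x` of the stalk. -/
abbrev mSub (M : S.Mods) (x : S.Pt) : Submodule (S.Ox x) (stalk M x) :=
  IsLocalRing.maximalIdeal (S.Ox x) • (⊤ : Submodule (S.Ox x) (stalk M x))

/-- The fibre `M ⊗ k(x) = M_x / 𝔪_x M_x`, a vector space over `k(x)`. -/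
def fibre (M : S.Mods) (x : S.Pt) : ModuleCat.{0} (S.kx x) :=
  ModuleCat.of (S.kx x) (stalk M x ⧸ mSub M x)

/-- An additive map on stalks that is `𝒪_x`-linear modulo `𝔪_x` preserves `𝔪_x M_x`. -/
lemma mSub_le {M N : S.Mods} {x : S.Pt} (φ : stalk M x →+ stalk N x)
    (h : ∀ (a : S.Ox x) (s : stalk M x), φ (a • s) - a • φ s ∈ mSub N x) :
    (mSub M x).toAddSubgroup ≤ (mSub N x).toAddSubgroup.comap φ := by
  intro s hs
  change φ s ∈ mSub N x
  refine Submodule.smul_induction_on (p := fun s => φ s ∈ mSub N x) hs ?_ ?_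
  · intro a ha s _
    have h1 := h a s
    have h2 : a • φ s ∈ mSub N x := Submodule.smul_mem_smul ha trivial
    simpa using add_mem h1 h2
  · intro s t hs ht
    rw [map_add]
    exact add_mem hs ht

/-- The map on fibres induced by an additive map on stalks that is `𝒪_x`-linear modulo `𝔪_x`. -/
def fibreMap {M N : S.Mods} {x : S.Pt} (φ : stalk M x →+ stalk N x)
    (h : ∀ (a : S.Ox x) (s : stalk M x), φ (a • s) - a • φ s ∈ mSub N x) :
    fibre M x ⟶ fibre N x :=
  ModuleCat.ofHom
    { toFun := QuotientAddGroup.map (mSub M x).toAddSubgroup (mSub N x).toAddSubgroup φ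
        (mSub_le φ h)
      map_add' := map_add _
      map_smul' := by
        intro a s
        obtain ⟨a, rfl⟩ := Ideal.Quotient.mk_surjective a
        obtain ⟨s, rfl⟩ := Submodule.Quotient.mk_surjective _ s
        exact (Submodule.Quotient.eq _).mpr (h a s) }

/-- The map on stalks induced by a morphism of sheaves of modules. -/
def stalkMap {M N : S.Mods} (φ : M ⟶ N) (x : S.Pt) : stalk M x →+ stalk N x :=
  ((TopCat.Presheaf.stalkFunctor Ab (X := S.Pt) x).map
    ((PresheafOfModules.toPresheaf _).map φ.val)).hom

lemma stalkMap_germ {M N : S.Mods} (φ : M ⟶ N) {U : Opens S.Pt} {x : S.Pt} (hx : x ∈ U)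
    (m : Sec M U) : stalkMap φ x (mgerm M hx m) = mgerm N hx (mapSec φ U m) :=
  TopCat.Presheaf.stalkFunctor_map_germ_apply (C := Ab) (X := S.Pt) U x hx
    ((PresheafOfModules.toPresheaf _).map φ.val) m

lemma exists_germ₂ (M : S.Mods) {x : S.Pt} {T : Opens S.Pt} (hT : x ∈ T) (a : S.Ox x)
    (s : stalk M x) : ∃ (U : Opens S.Pt) (hx : x ∈ U) (_ : U ≤ T) (b : S.O U) (m : Sec M U),
      S.germ hx b = a ∧ mgerm M hx m = s := by
  obtain ⟨U, hxU, b, rfl⟩ := TopCat.Presheaf.exists_germ_eq S.X.presheaf a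
  obtain ⟨V, hxV, m, rfl⟩ := exists_mgerm M s
  have h : U ⊓ V ⊓ T ≤ U := inf_le_left.trans inf_le_left
  refine ⟨U ⊓ V ⊓ T, ⟨⟨hxU, hxV⟩, hT⟩, inf_le_right, S.res h b,
    rs M (inf_le_left.trans inf_le_right) m, ?_, ?_⟩
  · exact TopCat.Presheaf.germ_res_apply S.X.presheaf (homOfLE h) x ⟨⟨hxU, hxV⟩, hT⟩ b
  · exact mgerm_res M _ _ m

lemma stalkMap_smul {M N : S.Mods} (φ : M ⟶ N) (x : S.Pt) (a : S.Ox x) (s : stalk M x) :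
    stalkMap φ x (a • s) = a • stalkMap φ x s := by
  obtain ⟨U, hx, _, b, m, rfl, rfl⟩ := exists_germ₂ M (T := ⊤) trivial a s
  rw [← mgerm_smul, stalkMap_germ, stalkMap_germ, map_smul, mgerm_smul]

/-- The fibre at `x` as a functor. -/
def fibreFunctor (x : S.Pt) : S.Mods ⥤ ModuleCat.{0} (S.kx x) where
  obj M := fibre M x
  map φ := fibreMap (stalkMap φ x) (fun a s => by simp [stalkMap_smul])
  map_id M := by
    ext s
    obtain ⟨s, rfl⟩ := Submodule.Quotient.mk_surjective _ s
    obtain ⟨U, hx, m, rfl⟩ := exists_mgerm M s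
    exact congrArg (Submodule.Quotient.mk (p := mSub M x)) (stalkMap_germ (𝟙 M) hx m)
  map_comp {M N P} φ ψ := by
    ext s
    obtain ⟨s, rfl⟩ := Submodule.Quotient.mk_surjective _ s
    obtain ⟨U, hx, m, rfl⟩ := exists_mgerm M s
    refine congrArg (Submodule.Quotient.mk (p := mSub P x)) ?_
    rw [stalkMap_germ, stalkMap_germ, stalkMap_germ]
    rfl

instance (x : S.Pt) : (fibreFunctor (S := S) x).PreservesZeroMorphisms where
  map_zero M N := by
    ext s
    obtain ⟨s, rfl⟩ := Submodule.Quotient.mk_surjective _ s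
    obtain ⟨U, hx, m, rfl⟩ := exists_mgerm M s
    refine congrArg (Submodule.Quotient.mk (p := mSub N x)) ?_
    rw [stalkMap_germ]
    exact map_zero _

/-- The fibre `F_x = F ⊗ k(x)` of a complex `F`. -/
abbrev fibreComplex (F : CochainComplex S.Mods ℤ) (x : S.Pt) :
    CochainComplex (ModuleCat.{0} (S.kx x)) ℤ :=
  ((fibreFunctor x).mapHomologicalComplex _).obj F

/-! ### Logarithmic differential operators of order at most one -/

/-- A differential operator of order `≤ 1` on `U` whose symbol is a vector field tangent to the
divisor `[x]`, i.e. vanishing at `x`: a `ℂ`-linear endomorphism `P` of the sheaf `𝒪|_U` such that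
`[[P, a], b] = 0` for all functions `a`, `b`, and such that all values of the symbol
`a ↦ [P, a] = P(a) - a P(1)` vanish at `x`. -/
@[ext]
structure LogDiffOp (x : S.Pt) (U : Opens S.Pt) where
  /-- the operator on functions on an open subset of `U` -/
  app : ∀ V : Opens S.Pt, V ≤ U → (S.O V →+ S.O V)
  app_res : ∀ {V W : Opens S.Pt} (hV : V ≤ U) (h : W ≤ V) (f : S.O V),
    app W (h.trans hV) (S.res h f) = S.res h (app V hV f)
  app_cst : ∀ (V : Opens S.Pt) (hV : V ≤ U) (c : ℂ) (f : S.O V),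
    app V hV (S.cst V c * f) = S.cst V c * app V hV f
  order_le_one : ∀ (V : Opens S.Pt) (hV : V ≤ U) (a b f : S.O V),
    app V hV (a * (b * f)) - a * app V hV (b * f) - b * app V hV (a * f) + a * b * app V hV f = 0
  tangent : ∀ (V : Opens S.Pt) (hV : V ≤ U) (hx : x ∈ V) (a : S.O V),
    S.germ hx (app V hV a - a * app V hV 1) ∈ IsLocalRing.maximalIdeal (S.Ox x)

namespace LogDiffOp

variable {x : S.Pt} {U : Opens S.Pt}

/-- Restriction to a smaller open subset. -/
def restrict (v : LogDiffOp x U) {V : Opens S.Pt} (h : V ≤ U) : LogDiffOp x V where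
  app W hW := v.app W (hW.trans h)
  app_res _ h' f := v.app_res _ h' f
  app_cst V _ := v.app_cst V _
  order_le_one V _ := v.order_le_one V _
  tangent V _ := v.tangent V _

/-- Addition of operators. -/
instance : Add (LogDiffOp x U) where
  add v w :=
    { app V hV := v.app V hV + w.app V hV
      app_res hV h f := by simp [v.app_res hV h f, w.app_res hV h f]
      app_cst V hV c f := by simp [v.app_cst V hV c f, w.app_cst V hV c f, mul_add]
      order_le_one V hV a b f := by
        simp only [AddMonoidHom.add_apply]
        linear_combination v.order_le_one V hV a b f + w.order_le_one V hV a b f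
      tangent V hV hx a := by
        have h := add_mem (v.tangent V hV hx a) (w.tangent V hV hx a)
        rw [← map_add] at h
        convert h using 2
        simp only [AddMonoidHom.add_apply]
        ring }

/-- The left `𝒪`-module structure: `(a • v)(f) = a v(f)`. -/
instance : SMul (S.O U) (LogDiffOp x U) where
  smul a v :=
    { app V hV := (AddMonoidHom.mulLeft (S.res hV a)).comp (v.app V hV)
      app_res {V W} hV h f := by
        have e : S.res (h.trans hV) a = S.res h (S.res hV a) :=
          ConcreteCategory.congr_hom (S.X.presheaf.map_comp (homOfLE hV).op (homOfLE h).op) a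
        simp [v.app_res hV h f, e]
      app_cst V hV c f := by simp [v.app_cst V hV c f, mul_left_comm]
      order_le_one V hV b c f := by
        simp only [AddMonoidHom.comp_apply, AddMonoidHom.coe_mulLeft]
        linear_combination S.res hV a * v.order_le_one V hV b c f
      tangent V hV hx b := by
        have h := Ideal.mul_mem_left _ (S.germ hx (S.res hV a)) (v.tangent V hV hx b)
        rw [← map_mul] at h
        convert h using 2
        simp only [AddMonoidHom.comp_apply, AddMonoidHom.coe_mulLeft]
        ring }

/-- The right `𝒪`-module structure: `(v a)(f) = v(a f)`. -/
def mulRight (v : LogDiffOp x U) (a : S.O U) : LogDiffOp x U where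
  app V hV := (v.app V hV).comp (AddMonoidHom.mulLeft (S.res hV a))
  app_res {V W} hV h f := by
    have e : S.res (h.trans hV) a = S.res h (S.res hV a) :=
      ConcreteCategory.congr_hom (S.X.presheaf.map_comp (homOfLE hV).op (homOfLE h).op) a
    simp [← v.app_res hV h, e]
  app_cst V hV c f := by simp [← v.app_cst V hV, mul_left_comm]
  order_le_one V hV b c f := by
    simp only [AddMonoidHom.comp_apply, AddMonoidHom.coe_mulLeft]
    have h := v.order_le_one V hV b c (S.res hV a * f)
    simp only [mul_left_comm _ (S.res hV a)] at h ⊢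
    exact h
  tangent V hV hx b := by
    have h := Ideal.mul_mem_left _ (S.germ hx (S.res hV a)) (v.tangent V hV hx b)
    rw [← map_mul] at h
    convert h using 2
    simp only [AddMonoidHom.comp_apply, AddMonoidHom.coe_mulLeft]
    have h' := v.order_le_one V hV b (S.res hV a) 1
    rw [mul_one, mul_one, mul_comm b] at h'
    rw [mul_one]
    linear_combination h'

/-- The function `1`, as a differential operator of order zero. -/
instance : One (LogDiffOp x U) where
  one :=
    { app V hV := AddMonoidHom.id _
      app_res _ _ _ := rfl
      app_cst _ _ _ _ := rfl
      order_le_one _ _ a b f := by simp only [AddMonoidHom.id_apply]; ring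
      tangent _ _ _ a := by simp }

/-- The symbol of `v` applied to the function `a`, that is `[v, a]`. -/
def symbol (v : LogDiffOp x U) (a : S.O U) : S.O U :=
  v.app U le_rfl a - a * v.app U le_rfl 1

/-- `v a = a v + σ(v)(a)`. -/
lemma mulRight_eq (v : LogDiffOp x U) (a : S.O U) :
    v.mulRight a = a • v + v.symbol a • (1 : LogDiffOp x U) := by
  ext V hV f
  change v.app V hV (S.res hV a * f) =
    S.res hV a * v.app V hV f + S.res hV (v.app U le_rfl a - a * v.app U le_rfl 1) * f
  have h1 := v.app_res le_rfl hV a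
  have h2 := v.app_res le_rfl hV 1
  rw [map_one] at h2
  rw [map_sub (S.res hV), map_mul (S.res hV), ← h1, ← h2]
  have h := v.order_le_one V hV (S.res hV a) f 1
  rw [mul_one, mul_one] at h
  linear_combination h

lemma one_mulRight (a : S.O U) : (1 : LogDiffOp x U).mulRight a = a • 1 := rfl

lemma restrict_mulRight (v : LogDiffOp x U) (a : S.O U) {V : Opens S.Pt} (h : V ≤ U) :
    (v.mulRight a).restrict h = (v.restrict h).mulRight (S.res h a) := by
  ext W hW f
  have e : S.res (hW.trans h) a = S.res hW (S.res h a) :=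
    ConcreteCategory.congr_hom (S.X.presheaf.map_comp (homOfLE h).op (homOfLE hW).op) a
  change v.app W _ (S.res (hW.trans h) a * f) = v.app W _ (S.res hW (S.res h a) * f)
  rw [e]

/-- `v` is the vector field `t ∂/∂t`, where `t` is a coordinate at `x`, i.e. a generator of `𝔪_x`:
it is a derivation (`v(1) = 0`) and `v(t) = t`. On a curve this determines `v` near `x`, and the
class of `v` in the fibre at `x` does not depend on the coordinate. -/
def IsEuler (v : LogDiffOp x U) (hx : x ∈ U) (t : S.O U) : Prop :=
  IsLocalRing.maximalIdeal (S.Ox x) = Ideal.span {S.germ hx t} ∧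
    v.app U le_rfl 1 = 0 ∧ v.app U le_rfl t = t

end LogDiffOp

/-! ### Actions of the sheaf of logarithmic differential operators -/

/-- A morphism `M : 𝓛 ⊗_𝒪 F ⟶ F` of complexes of sheaves of left `𝒪`-modules, where the tensor
product uses the right module structure of the sheaf `𝓛` of operators `LogDiffOp x`. By the
universal property of the tensor product, it is a compatible family of biadditive maps
`𝓛(U) × Fⁱ(U) → Fⁱ(U)` which are balanced, left linear and commute with the differentials. -/
structure LogAction (x : S.Pt) (F : CochainComplex S.Mods ℤ) where
  /-- the section `M(v ⊗ f)` for a section `f` of `Fⁱ` -/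
  act : ∀ {U : Opens S.Pt}, LogDiffOp x U → ∀ i : ℤ, Sec (F.X i) U →+ Sec (F.X i) U
  act_add : ∀ {U : Opens S.Pt} (v w : LogDiffOp x U) (i : ℤ) (f : Sec (F.X i) U),
    act (v + w) i f = act v i f + act w i f
  act_smul : ∀ {U : Opens S.Pt} (a : S.O U) (v : LogDiffOp x U) (i : ℤ) (f : Sec (F.X i) U),
    act (a • v) i f = a • act v i f
  act_mulRight : ∀ {U : Opens S.Pt} (v : LogDiffOp x U) (a : S.O U) (i : ℤ) (f : Sec (F.X i) U),
    act (v.mulRight a) i f = act v i (a • f)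
  act_res : ∀ {U V : Opens S.Pt} (h : V ≤ U) (v : LogDiffOp x U) (i : ℤ) (f : Sec (F.X i) U),
    act (v.restrict h) i (rs (F.X i) h f) = rs (F.X i) h (act v i f)
  act_d : ∀ {U : Opens S.Pt} (v : LogDiffOp x U) (i j : ℤ) (f : Sec (F.X i) U),
    act v j (mapSec (F.d i j) U f) = mapSec (F.d i j) U (act v i f)

namespace LogAction

variable {x : S.Pt} {F : CochainComplex S.Mods ℤ} (M : LogAction x F)

/-- The restriction `M₀ : F ⟶ F` of the action to the scalars `𝒪 ⊆ 𝓛`. -/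
def scalar : F ⟶ F where
  f i := ⟨PresheafOfModules.homMk
    { app U := AddCommGrpCat.ofHom (M.act (1 : LogDiffOp x U.unop) i)
      naturality U V h := by
        ext f
        exact M.act_res (leOfHom h.unop) 1 i f }
    (fun U (r : S.O U.unop) (m : Sec (F.X i) U.unop) => by
      change M.act 1 i (r • m) = r • M.act 1 i m
      rw [← M.act_mulRight, LogDiffOp.one_mulRight, M.act_smul])⟩
  comm' i j _ := by
    ext U f
    exact (M.act_d (U := U.unop) 1 i j f).symm

lemma act_germ {U : Opens S.Pt} (v : LogDiffOp x U) (i : ℤ) {V W T : Opens S.Pt}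
    (hV : V ≤ W) (hVU : V ≤ U) (hT : T ≤ V) (hx : x ∈ T) (f : Sec (F.X i) W) :
    mgerm (F.X i) (hT hx) (M.act (v.restrict hVU) i (rs (F.X i) hV f)) =
      mgerm (F.X i) hx (M.act (v.restrict (hT.trans hVU)) i (rs (F.X i) (hT.trans hV) f)) := by
  have e : rs (F.X i) (hT.trans hV) f = rs (F.X i) hT (rs (F.X i) hV f) :=
    ConcreteCategory.congr_hom ((F.X i).val.presheaf.map_comp (homOfLE hV).op (homOfLE hT).op) f
  have e' : v.restrict (hT.trans hVU) = (v.restrict hVU).restrict hT := rfl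
  rw [e, e', M.act_res, mgerm_res]

/-- The cocone of maps `Fⁱ(W) → (Fⁱ)_x` sending `f` to the germ of `M(v ⊗ f)`. -/
def stalkCocone {U : Opens S.Pt} (hx : x ∈ U) (v : LogDiffOp x U) (i : ℤ) :
    Limits.Cocone ((OpenNhds.inclusion x).op ⋙ (F.X i).val.presheaf) where
  pt := TopCat.Presheaf.stalk (C := Ab) (X := S.Pt) (F.X i).val.presheaf x
  ι :=
  { app W := AddCommGrpCat.ofHom ((mgerm (F.X i) (U := W.unop.1 ⊓ U) ⟨W.unop.2, hx⟩).comp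
      ((M.act (v.restrict inf_le_right) i).comp (rs (F.X i) inf_le_left)))
    naturality W W' h := by
      ext f
      have hle : W'.unop.1 ≤ W.unop.1 := leOfHom h.unop
      have e : rs (F.X i) (inf_le_left : W'.unop.1 ⊓ U ≤ W'.unop.1) (rs (F.X i) hle f) =
          rs (F.X i) (inf_le_left.trans hle) f :=
        (ConcreteCategory.congr_hom ((F.X i).val.presheaf.map_comp (homOfLE hle).op
          (homOfLE inf_le_left).op) f).symm
      change mgerm (F.X i) (U := W'.unop.1 ⊓ U) ⟨W'.unop.2, hx⟩
          (M.act (v.restrict inf_le_right) i (rs (F.X i) inf_le_left (rs (F.X i) hle f))) =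
        mgerm (F.X i) (U := W.unop.1 ⊓ U) ⟨W.unop.2, hx⟩
          (M.act (v.restrict inf_le_right) i (rs (F.X i) inf_le_left f))
      rw [e]
      exact (M.act_germ v i (V := W.unop.1 ⊓ U) (T := W'.unop.1 ⊓ U) inf_le_left inf_le_right
        (inf_le_inf_right U hle) ⟨W'.unop.2, hx⟩ f).symm }

/-- The endomorphism of the stalk of `Fⁱ` at `x` given by a logarithmic differential operator on a
neighbourhood of `x`. -/
def stalkAct {U : Opens S.Pt} (hx : x ∈ U) (v : LogDiffOp x U) (i : ℤ) :
    stalk (F.X i) x →+ stalk (F.X i) x :=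
  AddCommGrpCat.Hom.hom (Limits.colimit.desc _ (M.stalkCocone hx v i))

lemma stalkAct_germ {U : Opens S.Pt} (hx : x ∈ U) (v : LogDiffOp x U) (i : ℤ) {W : Opens S.Pt}
    (hW : x ∈ W) (h : W ≤ U) (f : Sec (F.X i) W) :
    M.stalkAct hx v i (mgerm (F.X i) hW f) = mgerm (F.X i) hW (M.act (v.restrict h) i f) := by
  have e := ConcreteCategory.congr_hom
    (Limits.colimit.ι_desc (M.stalkCocone hx v i) (op (⟨W, hW⟩ : OpenNhds x))) f
  refine e.trans ?_
  refine (M.act_germ v i (V := W ⊓ U) (T := W) inf_le_left inf_le_right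
    (le_inf le_rfl h) hW f).trans ?_
  have e' : rs (F.X i) (le_refl W) f = f :=
    ConcreteCategory.congr_hom ((F.X i).val.presheaf.map_id (op W)) f
  exact congrArg (fun g => mgerm (F.X i) hW (M.act (v.restrict h) i g)) e'

lemma stalkAct_smul {U : Opens S.Pt} (hx : x ∈ U) (v : LogDiffOp x U) (i : ℤ) (a : S.Ox x)
    (s : stalk (F.X i) x) :
    M.stalkAct hx v i (a • s) - a • M.stalkAct hx v i s ∈ mSub (F.X i) x := by
  obtain ⟨W, hW, h, b, m, rfl, rfl⟩ := exists_germ₂ (F.X i) hx a s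
  rw [← mgerm_smul, M.stalkAct_germ hx v i hW h, M.stalkAct_germ hx v i hW h, ← mgerm_smul,
    ← M.act_mulRight, LogDiffOp.mulRight_eq, M.act_add, M.act_smul, M.act_smul, map_add,
    add_sub_cancel_left, mgerm_smul]
  exact Submodule.smul_mem_smul (v.tangent W h hW b) trivial

/-- The endomorphism of the fibre `F_x` given by the class in `𝓛_x` of a logarithmic differential
operator on a neighbourhood of `x`. -/
def fibreAct {U : Opens S.Pt} (hx : x ∈ U) (v : LogDiffOp x U) :
    fibreComplex F x ⟶ fibreComplex F x where
  f i := fibreMap (M.stalkAct hx v i) (M.stalkAct_smul hx v i)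
  comm' i j _ := by
    ext s
    obtain ⟨s, rfl⟩ := Submodule.Quotient.mk_surjective _ s
    refine congrArg (Submodule.Quotient.mk (p := mSub (F.X j) x)) ?_
    obtain ⟨W, hW, h, -, m, -, rfl⟩ := exists_germ₂ (F.X i) hx 0 s
    rw [M.stalkAct_germ hx v i hW h, stalkMap_germ, stalkMap_germ, M.stalkAct_germ hx v j hW h,
      M.act_d]

end LogAction

/-! ### Vector bundles and the splitting of complexes -/

/-- A vector bundle: a sheaf of modules that is locally free of finite rank. -/
def IsVectorBundle (M : S.Mods) : Prop :=
  ∀ y : S.Pt, ∃ (U : Opens S.Pt) (_ : y ∈ U) (n : ℕ),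
    Nonempty (M.over U ≅ SheafOfModules.free (R := S.ringSheaf.over U) (Fin n))

/-- A complex of vector bundles of finite length. -/
def IsBundleComplex (F : CochainComplex S.Mods ℤ) : Prop :=
  (∀ i, IsVectorBundle (F.X i)) ∧ ∃ a b : ℤ, F.IsStrictlyGE a ∧ F.IsStrictlyLE b

instance (U : Opens S.Pt) : (SheafOfModules.overFunctor S.ringSheaf U).PreservesZeroMorphisms where
  map_zero _ _ := rfl

/-- The restriction `F|_U` of a complex to the open subset `U`. -/
abbrev restrictComplex (F : CochainComplex S.Mods ℤ) (U : Opens S.Pt) :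
    CochainComplex (S.ModsOver U) ℤ :=
  ((SheafOfModules.overFunctor S.ringSheaf U).mapHomologicalComplex _).obj F

/-- The direct sum `⨁ Hⁱ(K)[-i]` of the cohomology sheaves of a complex of sheaves of modules over
`U`, i.e. the complex with terms `Hⁱ(K)` and zero differentials. -/
def cohomologySum {U : Opens S.Pt} (K : CochainComplex (S.ModsOver U) ℤ) :
    CochainComplex (S.ModsOver U) ℤ where
  X i := K.homology i
  d _ _ := 0

/-- In a neighbourhood `U` of `x`, the complex `F` is homotopy equivalent to the direct sum of its
cohomology sheaves, and these are free of finite rank on `U`. -/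
def SplitsNear (F : CochainComplex S.Mods ℤ) (x : S.Pt) : Prop :=
  ∃ (U : Opens S.Pt) (_ : x ∈ U),
    Nonempty (HomotopyEquiv (restrictComplex F U) (cohomologySum (restrictComplex F U))) ∧
    ∀ i : ℤ, ∃ n : ℕ, Nonempty ((restrictComplex F U).homology i ≅
      SheafOfModules.free (R := S.ringSheaf.over U) (Fin n))

end CSpace
end

/-! The local ring `A` of `S` at `x` is a principal ideal domain with maximal ideal `(t)`: a smooth
curve is locally étale over the affine line, and on a disc a nonzero germ is a power of the
coordinate times a unit. The heart of the matter is that the cohomology of the complex of stalks at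
`x` has no `t`-torsion.

This is an eigenvalue argument, carried by `eq_zero_of_smul_eq_zero_of_nilpotent` and
`mem_range_of_smul_mem_range`. Let `D` be the action of `t ∂/∂t` on the cohomology `N` of the stalks
in degree `j`. The commutator `[t ∂/∂t, t] = t` gives `D t = t D + t M₀`. Since `N/tN` embeds into
the cohomology of the fibre, `M₀` is the identity and `D` is nilpotent on it; hence `D - k` is
nilpotent on `t^k N / t^(k+1) N`. The Bockstein map, which sends a class `f` of degree `j - 1` in
the fibre with `d f = t z` to the class of `z`, is onto the `t`-torsion of `N`. As `D (t z) = t (D z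
+ M₀ z)`, it intertwines `D` with `D + 1`, so `D + 1` is nilpotent on the torsion. In characteristic
zero `-1` differs from every `k ≥ 0`, so a torsion class lies in all `t^k N` and vanishes by Krull's
intersection theorem.

Boundaries are therefore saturated, cohomology is free, and the complex of stalks retracts by
deformation onto its cohomology (`exists_splitting`). The terms are finite free near `x` and almost
all are zero, so the finitely many maps and identities that express the retraction extend to a
neighbourhood (`CSpace.splitsNear_of_saturated`). -/

/-! ### Criteria for a local ring to be a principal ideal domain. -/

/-- A local ring in which every nonzero element is a power of a fixed non-nilpotent element times a
unit is a principal ideal domain. -/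
theorem isDomain_and_isPrincipalIdealRing_of_eq_pow_mul {A : Type*} [CommRing A] [Nontrivial A]
    (T : A) (hT : ∀ n : ℕ, T ^ n ≠ 0)
    (h : ∀ a : A, a ≠ 0 → ∃ (n : ℕ) (u : Aˣ), a = T ^ n * u) :
    IsDomain A ∧ IsPrincipalIdealRing A := by
  classical
  refine ⟨?_, ⟨fun I => ?_⟩⟩
  · have : NoZeroDivisors A := by
      refine ⟨fun {a b} hab => ?_⟩
      by_contra! hne
      obtain ⟨n, u, rfl⟩ := h a hne.1
      obtain ⟨m, w, rfl⟩ := h b hne.2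
      apply hT (n + m)
      have : T ^ (n + m) * ((u * w : Aˣ) : A) = 0 := by
        rw [← hab, Units.val_mul]; ring
      exact (Units.mul_left_eq_zero _).mp this
    exact NoZeroDivisors.to_isDomain A
  · by_cases hI : I = ⊥
    · subst hI; exact ⟨0, by simp⟩
    · obtain ⟨a, ha, ha0⟩ := Submodule.exists_mem_ne_zero_of_ne_bot hI
      have hex : ∃ n, T ^ n ∈ I := by
        obtain ⟨n, u, rfl⟩ := h a ha0
        exact ⟨n, by simpa using I.mul_mem_right (↑u⁻¹) ha⟩
      refine ⟨T ^ Nat.find hex, le_antisymm (fun b hb => ?_) ?_⟩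
      · by_cases hb0 : b = 0
        · subst hb0; exact zero_mem _
        obtain ⟨n, u, rfl⟩ := h b hb0
        have hn : T ^ n ∈ I := by simpa using I.mul_mem_right (↑u⁻¹) hb
        exact Ideal.mem_span_singleton.mpr
          ((pow_dvd_pow T (Nat.find_min' hex hn)).mul_right _)
      · exact (Ideal.span_singleton_le_iff_mem _).mpr (Nat.find_spec hex)

/-- A Noetherian local ring whose maximal ideal is generated by a non-zero-divisor is a principal
ideal domain. -/
theorem isDomain_and_isPrincipalIdealRing_of_maximalIdeal_eq_span {A : Type*} [CommRing A]
    [IsLocalRing A] [IsNoetherianRing A] (T : A) (hT : T ∈ nonZeroDivisors A)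
    (h : IsLocalRing.maximalIdeal A = Ideal.span {T}) :
    IsDomain A ∧ IsPrincipalIdealRing A := by
  refine isDomain_and_isPrincipalIdealRing_of_eq_pow_mul T
    (fun n => nonZeroDivisors.ne_zero (pow_mem hT n)) fun a ha => ?_
  -- Krull's intersection theorem bounds the powers of `T` that divide `a`; the cofactor of the
  -- largest one is outside `(T)`, hence a unit.
  have hk : ∃ n, ¬ T ^ n ∣ a := by
    by_contra! hdvd
    apply ha
    rw [← Submodule.mem_bot A, ← Ideal.iInf_pow_eq_bot_of_isLocalRing (Ideal.span {T})
      (h ▸ (IsLocalRing.maximalIdeal.isMaximal A).ne_top)]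
    refine (Submodule.mem_iInf _).mpr fun n => ?_
    rw [Ideal.span_singleton_pow]
    exact Ideal.mem_span_singleton.mpr (hdvd n)
  classical
  have hpos : Nat.find hk ≠ 0 := fun h0 => Nat.find_spec hk (by rw [h0]; simp)
  obtain ⟨n, hn⟩ := Nat.exists_eq_succ_of_ne_zero hpos
  have hdvd : T ^ n ∣ a := not_not.mp (Nat.find_min hk (by omega))
  obtain ⟨b, rfl⟩ := hdvd
  have hb : IsUnit b := by
    by_contra hb
    have : b ∈ Ideal.span {T} := h ▸ (IsLocalRing.mem_maximalIdeal b).mpr hb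
    obtain ⟨c, rfl⟩ := Ideal.mem_span_singleton.mp this
    apply Nat.find_spec hk
    rw [hn]
    exact ⟨c, by rw [pow_succ]; ring⟩
  exact ⟨n, hb.unit, rfl⟩

/-- A flat Noetherian local algebra `B` over a local principal ideal domain `R` is a principal
ideal domain as soon as its maximal ideal is generated by the one of `R`. -/
theorem isDomain_and_isPrincipalIdealRing_of_flat {R B : Type*} [CommRing R] [IsDomain R]
    [IsPrincipalIdealRing R] [IsLocalRing R] [CommRing B] [IsLocalRing B] [IsNoetherianRing B]
    [Algebra R B] [Module.Flat R B]
    (h : (IsLocalRing.maximalIdeal R).map (algebraMap R B) = IsLocalRing.maximalIdeal B) :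
    IsDomain B ∧ IsPrincipalIdealRing B := by
  obtain ⟨w, hw⟩ := (IsPrincipalIdealRing.principal (IsLocalRing.maximalIdeal R)).principal
  have hw' : IsLocalRing.maximalIdeal B = Ideal.span {algebraMap R B w} := by
    rw [← h, hw, Ideal.submodule_span_eq, Ideal.map_span, Set.image_singleton]
  -- A zero generator means that `R` and `B` are both fields; otherwise flatness makes the image of
  -- `w` a non-zero-divisor.
  by_cases hw0 : w = 0
  · have hB : IsField B := by
      rw [IsLocalRing.isField_iff_maximalIdeal_eq, hw', hw0]
      simp
    let := hB.toField
    exact ⟨inferInstance, inferInstance⟩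
  · refine isDomain_and_isPrincipalIdealRing_of_maximalIdeal_eq_span (algebraMap R B w) ?_ hw'
    have hreg : IsSMulRegular B w :=
      Module.Flat.isSMulRegular_of_nonZeroDivisors (mem_nonZeroDivisors_of_ne_zero hw0)
    rw [mem_nonZeroDivisors_iff_right]
    intro b hb
    refine hreg ?_
    simp only [Algebra.smul_def, mul_zero]
    rw [mul_comm, hb]

/-! ### Absence of torsion, by comparing eigenvalues. -/

/-- Let `D` be an additive endomorphism of a finite module `N` over a Noetherian local ring
containing `ℚ` whose maximal ideal is generated by `t`, such that `D (t n) = t D n + t M n`, where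
`M` is the identity modulo `t`. If `D` is nilpotent modulo `t` and `D + 1` is nilpotent on the
`t`-torsion, then there is no `t`-torsion. -/
theorem eq_zero_of_smul_eq_zero_of_nilpotent {A N : Type*} [CommRing A] [IsLocalRing A]
    [IsNoetherianRing A] [AddCommGroup N] [Module A N] [Module.Finite A N]
    (hchar : ∀ n : ℕ, IsUnit ((n + 1 : ℕ) : A)) {t : A} (ht : ¬ IsUnit t)
    (D : N →+ N) (M : N →ₗ[A] N) (hD : ∀ n, D (t • n) = t • D n + t • M n)
    (hM : ∀ n, ∃ n', M n - n = t • n') {r : ℕ} (hr : ∀ n, ∃ n', (D^[r]) n = t • n')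
    {q : ℕ} (hq : ∀ n, t • n = 0 → ((D + AddMonoidHom.id N)^[q]) n = 0)
    {n : N} (hn : t • n = 0) : n = 0 := by
  have hDk : ∀ (k : ℕ) (m : N), D (t ^ k • m) = t ^ k • D m + (k : A) • t ^ k • M m := by
    intro k
    induction k with
    | zero => simp
    | succ k ih =>
      intro m
      rw [pow_succ', mul_smul, hD, ih, map_smul]
      push_cast
      module
  -- Modulo `t^(k+1) N` the element `n = t^k m` is killed by a power of `E = D - k`, and it is also
  -- killed by a power of `D + 1 = E + (k + 1)`. Since `k + 1` is invertible, `n` is zero modulo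
  -- `t^(k+1) N`.
  have key : ∀ k : ℕ, ∃ m, n = t ^ k • m := by
    intro k
    induction k with
    | zero => exact ⟨n, by simp⟩
    | succ k ih =>
      obtain ⟨m, hm⟩ := ih
      let W : Submodule A N := LinearMap.range (LinearMap.lsmul A N (t ^ (k + 1)))
      have hW : ∀ m, t ^ (k + 1) • m ∈ W := fun m => ⟨m, rfl⟩
      let E : N →+ N := D - (k : A) • (1 : Module.End A N).toAddMonoidHom
      have hE : ∀ m, E m = D m - (k : A) • m := fun _ => rfl
      have hEW : ∀ w ∈ W, E w ∈ W := by
        rintro _ ⟨m, rfl⟩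
        have : E (t ^ (k + 1) • m) = t ^ (k + 1) • (D m + ((k + 1 : ℕ) : A) • M m - (k : A) • m) := by
          rw [hE, hDk]; module
        change E (t ^ (k + 1) • m) ∈ W
        rw [this]; exact hW _
      -- The term `k t^k M m` of the Leibniz rule is cancelled by the shift `-k` up to `t^(k+1) N`,
      -- because `M m` is `m` modulo `t`.
      have hEs : ∀ (s : ℕ) (m : N), (E^[s]) (t ^ k • m) - t ^ k • (D^[s]) m ∈ W := by
        intro s m
        induction s with
        | zero => simp
        | succ s ih =>
          rw [Function.iterate_succ_apply', Function.iterate_succ_apply']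
          have h1 := hEW _ ih
          obtain ⟨p, hp⟩ := hM ((D^[s]) m)
          have h2 : E (t ^ k • (D^[s]) m) - t ^ k • D ((D^[s]) m) = t ^ (k + 1) • (k : A) • p := by
            rw [hE, hDk, sub_eq_iff_eq_add.mp hp]; module
          have h3 := add_mem h1 (h2 ▸ hW ((k : A) • p))
          rwa [map_sub, sub_add_sub_cancel] at h3
      have hEr : (E^[r]) n ∈ W := by
        obtain ⟨p, hp⟩ := hr m
        have h1 := hEs r m
        rw [hp, ← mul_smul, ← pow_succ, ← hm] at h1
        simpa using add_mem h1 (hW p)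
      let G : N →+ N := D + AddMonoidHom.id N
      have hG : ∀ m, G m = E m + ((k + 1 : ℕ) : A) • m := by
        intro m
        change D m + m = _
        rw [hE]; push_cast; module
      have hcomm : ∀ m, G (E m) = E (G m) := by
        have : ∀ m, E ((k + 1 : ℕ) • m) = (k + 1 : ℕ) • E m := fun m => map_nsmul E _ m
        intro m
        simp only [hG, map_add, Nat.cast_smul_eq_nsmul, this]
      have hGq : ∀ (q : ℕ) (m : N), E m ∈ W →
          (G^[q]) m - ((k + 1 : ℕ) : A) ^ q • m ∈ W := by
        intro q m hm
        induction q with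
        | zero => simp
        | succ q ih =>
          have h4 : E ((G^[q]) m) ∈ W := by
            clear ih
            induction q with
            | zero => simpa using hm
            | succ q ih =>
              rw [Function.iterate_succ_apply', ← hcomm, hG]
              exact add_mem (hEW _ ih) (W.smul_mem _ ih)
          rw [Function.iterate_succ_apply', hG, add_sub_assoc, pow_succ', mul_smul, ← smul_sub]
          exact add_mem h4 (W.smul_mem _ ih)
      -- One factor `E` is removed at a time: `E m` is again killed by `G^q` because `E` and `G`
      -- commute. Once `E m ∈ W`, the map `G^q` acts on `m` as the unit `(k + 1)^q` modulo `W`.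
      have hfin : ∀ (j : ℕ) (m : N), (G^[q]) m = 0 → (E^[j]) m ∈ W → m ∈ W := by
        intro j
        induction j with
        | zero => intro m _ h; exact h
        | succ j ih =>
          intro m hm h
          have h5 : E m ∈ W := by
            refine ih (E m) ?_ h
            rw [Function.Commute.iterate_left (f := G) (g := E) hcomm q m, hm, map_zero]
          have h6 := hGq q m h5
          rw [hm, zero_sub, neg_mem_iff] at h6
          obtain ⟨u, hu⟩ := (hchar k).pow q
          rw [← hu] at h6
          simpa [smul_smul] using W.smul_mem (↑u⁻¹ : A) h6
      obtain ⟨p, hp⟩ := hfin r n (hq n hn) hEr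
      exact ⟨p, hp.symm⟩
  have hI : Ideal.span {t} ≠ ⊤ := fun h => ht (Ideal.span_singleton_eq_top.mp h)
  rw [← Submodule.mem_bot A, ← Ideal.iInf_pow_smul_eq_bot_of_isLocalRing (M := N) _ hI]
  refine (Submodule.mem_iInf _).mpr fun k => ?_
  obtain ⟨m, hm⟩ := key k
  rw [hm, Ideal.span_singleton_pow]
  exact Submodule.smul_mem_smul (Ideal.mem_span_singleton_self _) trivial

/-- Let `P → Q → R` be a complex of modules over a local ring containing `ℚ` whose maximal ideal is
generated by the non-zero-divisor `t`, together with endomorphisms `M` and `D` such that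
`D (t f) = t D f + t M f`. If, modulo `t`, `M` is the identity and `D` is nilpotent on the cohomology
at `P` and `Q`, then the cohomology at `Q` has no `t`-torsion. -/
theorem mem_range_of_smul_mem_range {A P' P Q R : Type*} [CommRing A] [IsLocalRing A]
    [IsNoetherianRing A] [AddCommGroup P'] [Module A P'] [AddCommGroup P] [Module A P]
    [AddCommGroup Q] [Module A Q] [AddCommGroup R] [Module A R] [Module.Finite A Q]
    (hchar : ∀ n : ℕ, IsUnit ((n + 1 : ℕ) : A)) {t : A} (ht : ¬ IsUnit t)
    (htQ : IsSMulRegular Q t) (htR : IsSMulRegular R t)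
    (d' : P' →ₗ[A] P) (d : P →ₗ[A] Q) (e : Q →ₗ[A] R) (hd' : ∀ p, d (d' p) = 0)
    (hde : ∀ p, e (d p) = 0)
    (DP : P →+ P) (DQ : Q →+ Q) (DR : R →+ R) (MP : P →ₗ[A] P) (MQ : Q →ₗ[A] Q) (MR : R →ₗ[A] R)
    (hDd : ∀ p, DQ (d p) = d (DP p)) (hDe : ∀ p, DR (e p) = e (DQ p))
    (hMd : ∀ p, MQ (d p) = d (MP p)) (hMe : ∀ p, MR (e p) = e (MQ p))
    (hD : ∀ q, DQ (t • q) = t • DQ q + t • MQ q)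
    (hP : ∀ p, (∃ q, d p = t • q) → ∃ u w, MP p - p = t • u + d' w)
    (hQ : ∀ q, (∃ r, e q = t • r) → ∃ u w, MQ q - q = t • u + d w)
    {a b : ℕ}
    (ha : ∀ p, (∃ q, d p = t • q) → ∃ u w, (DP^[a]) p = t • u + d' w)
    (hb : ∀ q, (∃ r, e q = t • r) → ∃ u w, (DQ^[b]) q = t • u + d w)
    {p : P} {q : Q} (hpq : d p = t • q) : ∃ p', d p' = q := by
  let N := LinearMap.ker e ⧸ (LinearMap.range d).submoduleOf (LinearMap.ker e)
  let B := (LinearMap.range d).submoduleOf (LinearMap.ker e)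
  have hB : ∀ z : LinearMap.ker e, z ∈ B ↔ ∃ p, d p = z.1 := fun z => Iff.rfl
  let MZ : LinearMap.ker e →ₗ[A] LinearMap.ker e :=
    MQ.restrict (fun z hz => by rw [LinearMap.mem_ker] at hz ⊢; rw [← hMe, hz, map_zero])
  let MN : N →ₗ[A] N := B.mapQ B MZ (by
    rintro z ⟨p, hp⟩
    exact ⟨MP p, by rw [← hMd]; exact congrArg MQ hp⟩)
  let DZ : LinearMap.ker e →+ LinearMap.ker e :=
    { toFun := fun z => ⟨DQ z.1, by
        have := z.2; rw [LinearMap.mem_ker] at this ⊢; rw [← hDe, this, map_zero]⟩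
      map_zero' := by ext; exact map_zero DQ
      map_add' := fun x y => by ext; exact map_add DQ _ _ }
  let DN : N →+ N := QuotientAddGroup.map B.toAddSubgroup B.toAddSubgroup DZ (by
    rintro z ⟨p, hp⟩
    exact ⟨DP p, by rw [← hDd]; exact congrArg DQ hp⟩)
  have hDN : ∀ z : LinearMap.ker e, DN (B.mkQ z) = B.mkQ (DZ z) := fun z => rfl
  have hMN : ∀ z : LinearMap.ker e, MN (B.mkQ z) = B.mkQ (MZ z) := fun z => rfl
  have hfin : Module.Finite A N := inferInstance
  -- This is the injectivity of the map from the cohomology modulo `t` to the cohomology of the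
  -- reduction: `u` is itself a cycle since `R` has no `t`-torsion.
  have hcyc : ∀ (z : LinearMap.ker e) (u : Q) (w : P), z.1 = t • u + d w →
      ∃ n', B.mkQ z = t • n' := by
    intro z u w h
    have hu : e u = 0 := by
      refine htR ?_
      have := congrArg e h
      rw [map_add, map_smul, hde, add_zero, LinearMap.mem_ker.mp z.2] at this
      simpa using this.symm
    refine ⟨B.mkQ ⟨u, hu⟩, ?_⟩
    rw [← map_smul, ← sub_eq_zero, ← map_sub, Submodule.mkQ_apply, Submodule.Quotient.mk_eq_zero]
    exact ⟨w, by simp [h]⟩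
  have hDit : ∀ (s : ℕ) (z : LinearMap.ker e), (DN^[s]) (B.mkQ z) = B.mkQ ((DZ^[s]) z) := by
    intro s z
    induction s with
    | zero => rfl
    | succ s ih => rw [Function.iterate_succ_apply', ih, hDN, Function.iterate_succ_apply']
  have hDZit : ∀ (s : ℕ) (z : LinearMap.ker e), ((DZ^[s]) z).1 = (DQ^[s]) z.1 := by
    intro s z
    induction s with
    | zero => rfl
    | succ s ih => rw [Function.iterate_succ_apply', Function.iterate_succ_apply', ← ih]; rfl
  -- `MQ` is the identity on torsion classes, not only modulo `t`: apply `d` to `MP f - f = t u + d'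
  -- w` and cancel `t`.
  have hMtors : ∀ (z : LinearMap.ker e) (f : P), d f = t • z.1 → ∃ f', d f' = MQ z.1 - z.1 := by
    intro z f hf
    obtain ⟨u, w, huw⟩ := hP f ⟨_, hf⟩
    refine ⟨u, htQ ?_⟩
    have := congrArg d huw
    rw [map_sub, map_add, map_smul, hd', add_zero, ← hMd, hf, map_smul, ← smul_sub] at this
    exact this.symm
  have hpb : t • (B.mkQ ⟨q, by
      refine htR ?_
      change t • e q = t • 0
      rw [← map_smul, ← hpq, hde, smul_zero]⟩ : N) = 0 := by
    rw [← map_smul, Submodule.mkQ_apply, Submodule.Quotient.mk_eq_zero]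
    exact ⟨p, hpq⟩
  have := eq_zero_of_smul_eq_zero_of_nilpotent hchar ht DN MN ?_ ?_ (r := b) ?_ (q := a) ?_ hpb
  · rw [Submodule.mkQ_apply, Submodule.Quotient.mk_eq_zero] at this
    exact this
  · intro n
    obtain ⟨z, rfl⟩ := B.mkQ_surjective n
    have hz : DZ (t • z) = t • DZ z + t • MZ z := by
      ext
      exact hD z.1
    rw [← map_smul, hDN, hDN, hMN, hz, map_add, map_smul, map_smul]
  · intro n
    obtain ⟨z, rfl⟩ := B.mkQ_surjective n
    obtain ⟨u, w, huw⟩ := hQ z.1 ⟨0, by rw [LinearMap.mem_ker.mp z.2, smul_zero]⟩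
    rw [hMN, ← map_sub]
    exact hcyc (MZ z - z) u w huw
  · intro n
    obtain ⟨z, rfl⟩ := B.mkQ_surjective n
    obtain ⟨u, w, huw⟩ := hb z.1 ⟨0, by rw [LinearMap.mem_ker.mp z.2, smul_zero]⟩
    rw [hDit]
    exact hcyc _ u w (by rw [hDZit, huw])
  · intro n hn
    obtain ⟨z, rfl⟩ := B.mkQ_surjective n
    rw [← map_smul, Submodule.mkQ_apply, Submodule.Quotient.mk_eq_zero] at hn
    obtain ⟨f, hf⟩ := hn
    change d f = t • z.1 at hf
    -- The Bockstein map intertwines `DP` with `DN + 1`: from `d f = t y` follows `d (DP f) = t (DQ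
    -- y + MQ y)`, and `MQ y` is cohomologous to `y`.
    have hstep : ∀ s : ℕ, ∃ y : LinearMap.ker e, d ((DP^[s]) f) = t • y.1 ∧
        ((DN + AddMonoidHom.id N)^[s]) (B.mkQ z) = B.mkQ y := by
      intro s
      induction s with
      | zero => exact ⟨z, hf, rfl⟩
      | succ s ih =>
        obtain ⟨y, hy1, hy2⟩ := ih
        obtain ⟨f', hf'⟩ := hMtors y _ hy1
        refine ⟨DZ y + MZ y, ?_, ?_⟩
        · rw [Function.iterate_succ_apply', ← hDd, hy1, hD, ← smul_add]; rfl
        · rw [Function.iterate_succ_apply', hy2]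
          change DN (B.mkQ y) + B.mkQ y = _
          rw [hDN, map_add, add_right_inj, eq_comm, ← sub_eq_zero, ← map_sub, Submodule.mkQ_apply,
            Submodule.Quotient.mk_eq_zero]
          exact ⟨f', hf'⟩
    obtain ⟨y, hy1, hy2⟩ := hstep a
    rw [hy2]
    -- After `a` steps the class on the source of the Bockstein map is zero modulo `t`, so dividing
    -- its differential by `t` leaves the boundary `d u`.
    obtain ⟨u, w, huw⟩ := ha f ⟨_, hf⟩
    rw [huw, map_add, map_smul, hd', add_zero] at hy1
    rw [Submodule.mkQ_apply, Submodule.Quotient.mk_eq_zero]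
    exact ⟨u, htQ hy1⟩

/-! ### Splitting over a principal ideal domain. -/

/-- Over a local domain whose maximal ideal is generated by `t`, a submodule that is saturated with
respect to `t` is saturated. -/
theorem mem_of_smul_mem_of_maximalIdeal_eq_span {A Q : Type*} [CommRing A] [IsDomain A]
    [IsNoetherianRing A] [IsLocalRing A] [AddCommGroup Q] [Module A Q] {t : A}
    (ht : IsLocalRing.maximalIdeal A = Ideal.span {t}) {B : Submodule A Q}
    (hB : ∀ q, t • q ∈ B → q ∈ B) {a : A} (ha : a ≠ 0) {q : Q} (hq : a • q ∈ B) : q ∈ B := by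
  induction a using WfDvdMonoid.induction_on_irreducible generalizing q with
  | zero => exact absurd rfl ha
  | unit u hu =>
    obtain ⟨u, rfl⟩ := hu
    simpa [smul_smul] using B.smul_mem (↑u⁻¹ : A) hq
  | mul a i ha0 hi ih =>
    rw [mul_comm, mul_smul] at hq
    -- An irreducible element lies in `(t)`, hence is `t` times a unit.
    have hit : i ∈ Ideal.span {t} := ht ▸ (IsLocalRing.mem_maximalIdeal i).mpr hi.not_isUnit
    obtain ⟨c, rfl⟩ := Ideal.mem_span_singleton.mp hit
    have hc : IsUnit c := by
      refine (hi.isUnit_or_isUnit rfl).resolve_left ?_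
      have : t ∈ IsLocalRing.maximalIdeal A := ht ▸ Ideal.mem_span_singleton_self t
      exact (IsLocalRing.mem_maximalIdeal t).mp this
    obtain ⟨c, rfl⟩ := hc
    refine hB _ (ih ha0 ?_)
    have := B.smul_mem (↑c⁻¹ : A) hq
    have e : (↑c⁻¹ : A) • a • (t * ↑c) • q = a • t • q := by
      simp only [smul_smul]
      congr 1
      have := c.inv_mul
      linear_combination (a * t) * this
    rwa [e] at this

theorem quotient_isTorsionFree_of_saturated {A Q : Type*} [CommRing A] [IsDomain A]
    [AddCommGroup Q] [Module A Q] {B : Submodule A Q}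
    (hB : ∀ (a : A) (q : Q), a ≠ 0 → a • q ∈ B → q ∈ B) : Module.IsTorsionFree A (Q ⧸ B) := by
  refine .of_smul_eq_zero fun a q h => ?_
  obtain ⟨q, rfl⟩ := B.mkQ_surjective q
  by_cases ha : a = 0
  · exact Or.inl ha
  · refine Or.inr ?_
    rw [← map_smul, Submodule.mkQ_apply, Submodule.Quotient.mk_eq_zero] at h
    rw [Submodule.mkQ_apply, Submodule.Quotient.mk_eq_zero]
    exact hB a q ha h

/-- A map of finite free modules over a principal ideal domain with torsion-free cokernel has a
generalized inverse. -/
theorem exists_generalized_inverse {A P Q : Type*} [CommRing A] [IsDomain A]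
    [IsPrincipalIdealRing A] [AddCommGroup P] [Module A P] [AddCommGroup Q] [Module A Q]
    [Module.Finite A Q] [Module.Free A Q] (d : P →ₗ[A] Q)
    (hd : ∀ (a : A) (q : Q), a ≠ 0 → a • q ∈ LinearMap.range d → q ∈ LinearMap.range d) :
    ∃ s : Q →ₗ[A] P, ∀ p, d (s (d p)) = d p := by
  have := quotient_isTorsionFree_of_saturated hd
  have : Module.Free A (Q ⧸ LinearMap.range d) := Module.free_of_finite_type_torsion_free'
  obtain ⟨σ, hσ⟩ := Module.projective_lifting_property (LinearMap.range d).mkQ LinearMap.id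
    (Submodule.mkQ_surjective _)
  have hσ' : ∀ y, (LinearMap.range d).mkQ (σ y) = y := fun y => LinearMap.congr_fun hσ y
  -- The cokernel is free, so its section `σ` gives a projection `π` of `Q` onto the range of `d`;
  -- `s` is a lift of `π` through `d`, which exists as `Q` is projective.
  let π : Q →ₗ[A] LinearMap.range d :=
    (LinearMap.id - σ ∘ₗ (LinearMap.range d).mkQ).codRestrict _ fun q => by
      rw [← Submodule.Quotient.mk_eq_zero, ← Submodule.mkQ_apply]
      simp [hσ', -Submodule.mkQ_apply]
  obtain ⟨s, hs⟩ := Module.projective_lifting_property d.rangeRestrict π d.surjective_rangeRestrict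
  refine ⟨s, fun p => ?_⟩
  have h1 : d (s (d p)) = (π (d p)).1 := congrArg Subtype.val (LinearMap.congr_fun hs (d p))
  have h2 : (LinearMap.range d).mkQ (d p) = 0 := by
    rw [Submodule.mkQ_apply, Submodule.Quotient.mk_eq_zero]; exact ⟨p, rfl⟩
  rw [h1]
  change d p - σ ((LinearMap.range d).mkQ (d p)) = d p
  rw [h2, map_zero, sub_zero]

/-- The splitting, at the middle term, of a complex of finite free modules with torsion-free
cohomology over a principal ideal domain. -/
theorem exists_splitting_at {A P Q R : Type*} [CommRing A] [IsDomain A]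
    [IsPrincipalIdealRing A] [AddCommGroup P] [Module A P] [AddCommGroup Q] [Module A Q]
    [AddCommGroup R] [Module A R] [Module.Finite A Q]
    (d : P →ₗ[A] Q) (e : Q →ₗ[A] R) (hde : ∀ p, e (d p) = 0)
    (hd : ∀ (a : A) (q : Q), a ≠ 0 → a • q ∈ LinearMap.range d → q ∈ LinearMap.range d)
    (s : Q →ₗ[A] P) (hs : ∀ p, d (s (d p)) = d p)
    (s' : R →ₗ[A] Q) (hs' : ∀ q, e (s' (e q)) = e q) :
    ∃ (n : ℕ) (a : (Fin n → A) →ₗ[A] Q) (b : Q →ₗ[A] (Fin n → A)) (h : Q →ₗ[A] P),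
      (∀ y, b (a y) = y) ∧ (∀ y, e (a y) = 0) ∧ (∀ p, b (d p) = 0) ∧
      (∀ p, h (d p) = s (d p)) ∧ ∀ q, q - a (b q) = d (h q) + s' (e q) := by
  let B := (LinearMap.range d).submoduleOf (LinearMap.ker e)
  have : Module.IsTorsionFree A (LinearMap.ker e ⧸ B) :=
    quotient_isTorsionFree_of_saturated fun a z ha hz => hd a z.1 ha hz
  have : Module.Free A (LinearMap.ker e ⧸ B) := Module.free_of_finite_type_torsion_free'
  let β := (Module.finBasis A (LinearMap.ker e ⧸ B)).equivFun
  obtain ⟨σ, hσ⟩ := Module.projective_lifting_property B.mkQ LinearMap.id B.mkQ_surjective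
  have hσ' : ∀ y, B.mkQ (σ y) = y := fun y => LinearMap.congr_fun hσ y
  -- The identity `e s' e = e` makes `s' e` idempotent with kernel `ker e`, so `π` is the
  -- complementary projection onto the cycles.
  let π : Q →ₗ[A] LinearMap.ker e := (LinearMap.id - s' ∘ₗ e).codRestrict _ fun q => by simp [hs']
  have hπ : ∀ q, (π q).1 = q - s' (e q) := fun q => rfl
  let a : (Fin _ → A) →ₗ[A] Q := (LinearMap.ker e).subtype ∘ₗ σ ∘ₗ β.symm.toLinearMap
  let b : Q →ₗ[A] (Fin _ → A) := β.toLinearMap ∘ₗ B.mkQ ∘ₗ π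
  have ha : ∀ y, a y = (σ (β.symm y)).1 := fun y => rfl
  have hb : ∀ q, b q = β (B.mkQ (π q)) := fun y => rfl
  have hea : ∀ y, e (a y) = 0 := fun y => LinearMap.mem_ker.mp (σ (β.symm y)).2
  have hbd : ∀ p, b (d p) = 0 := by
    intro p
    rw [hb, LinearEquiv.map_eq_zero_iff, Submodule.mkQ_apply, Submodule.Quotient.mk_eq_zero]
    exact ⟨p, by simp [hπ, hde]⟩
  -- Subtracting the cohomology part and the part complementary to the cycles leaves a boundary, on
  -- which `d s` is the identity. On boundaries the two corrections vanish, so the homotopy agrees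
  -- there with `s`.
  refine ⟨_, a, b, s ∘ₗ (LinearMap.id - a ∘ₗ b - s' ∘ₗ e), ?_, hea, hbd, ?_, ?_⟩
  · intro y
    have : π (a y) = σ (β.symm y) := by
      ext
      rw [hπ, hea, map_zero, sub_zero, ha]
    rw [hb, this, hσ', LinearEquiv.apply_symm_apply]
  · intro p
    simp [hbd, hde]
  · intro q
    have h1 : B.mkQ (π q - σ (β.symm (b q))) = 0 := by
      rw [map_sub, hσ', hb, LinearEquiv.symm_apply_apply, sub_self]
    rw [Submodule.mkQ_apply, Submodule.Quotient.mk_eq_zero] at h1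
    obtain ⟨p, hp⟩ := h1
    have hp' : d p = q - a (b q) - s' (e q) := by
      rw [hp]
      change (π q).1 - a (b q) = _
      rw [hπ]; abel
    change _ = d (s (q - a (b q) - s' (e q))) + _
    rw [← hp', hs, hp']
    abel

/-! ### Local rings of smooth curves. -/

theorem MvPolynomial.isPrincipalIdealRing_of_unique (K σ : Type*) [Field K] [Unique σ] :
    IsPrincipalIdealRing (MvPolynomial σ K) :=
  IsPrincipalIdealRing.of_surjective (MvPolynomial.uniqueAlgEquiv K σ).symm.toRingEquiv.toRingHom
    (MvPolynomial.uniqueAlgEquiv K σ).symm.surjective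

theorem IsLocalization.isPrincipalIdealRing_of_isPrincipalIdealRing {R : Type*} (S : Type*)
    [CommRing R] [CommRing S] [Algebra R S] (M : Submonoid R) [IsLocalization M S]
    [IsPrincipalIdealRing R] : IsPrincipalIdealRing S := by
  refine ⟨fun I => ?_⟩
  obtain ⟨a, ha⟩ := (IsPrincipalIdealRing.principal (I.under R)).principal
  refine ⟨algebraMap R S a, ?_⟩
  rw [← IsLocalization.map_under M S I, ha, Ideal.submodule_span_eq, Ideal.submodule_span_eq,
    Ideal.map_span, Set.image_singleton]

/-- The local rings of an étale algebra over a principal ideal domain are principal ideal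
domains. -/
theorem Algebra.Etale.isDomain_and_isPrincipalIdealRing_localization {R S : Type*} [CommRing R]
    [IsDomain R] [IsPrincipalIdealRing R] [CommRing S] [Algebra R S] [Algebra.Etale R S]
    (q : Ideal S) [q.IsPrime] :
    IsDomain (Localization.AtPrime q) ∧ IsPrincipalIdealRing (Localization.AtPrime q) := by
  let p := q.under R
  let := Localization.AtPrime.algebraOfLiesOver p q
  have : Algebra.FormallyUnramified (Localization.AtPrime p) (Localization.AtPrime q) :=
    .of_restrictScalars R _ _
  have : Algebra.EssFiniteType (Localization.AtPrime p) (Localization.AtPrime q) := .of_comp R _ _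
  have : Module.Flat R (Localization.AtPrime q) := Module.Flat.trans R S _
  have : IsPrincipalIdealRing (Localization.AtPrime p) :=
    IsLocalization.isPrincipalIdealRing_of_isPrincipalIdealRing _ p.primeCompl
  have : IsNoetherianRing S := Algebra.FiniteType.isNoetherianRing R S
  have : IsNoetherianRing (Localization.AtPrime q) :=
    IsLocalization.isNoetherianRing q.primeCompl _ inferInstance
  -- Being unramified says that the maximal ideal below generates the one above; flatness does the
  -- rest.
  exact isDomain_and_isPrincipalIdealRing_of_flat (R := Localization.AtPrime p)
    Algebra.FormallyUnramified.map_maximalIdeal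

/-- The local rings of a smooth curve over a field are principal ideal domains. -/
theorem AlgebraicGeometry.SmoothOfRelativeDimension.isDomain_and_isPrincipalIdealRing_stalk
    {K : Type} [Field K] {Y : Scheme.{0}} (f : Y ⟶ Spec (CommRingCat.of K))
    [SmoothOfRelativeDimension 1 f] (x : Y) :
    IsDomain (Y.presheaf.stalk x) ∧ IsPrincipalIdealRing (Y.presheaf.stalk x) := by
  obtain ⟨U, hU, V, hV, hxV, e, hf⟩ :=
    SmoothOfRelativeDimension.exists_isStandardSmoothOfRelativeDimension (n := 1) (f := f) x
  -- The spectrum of a field has a single point.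
  obtain rfl : U = ⊤ := by
    ext y
    have := Subsingleton.elim (f x) y
    simpa [← this] using e hxV
  have hK : IsField Γ(Spec (CommRingCat.of K), ⊤) :=
    (Scheme.ΓSpecIso (CommRingCat.of K)).commRingCatIsoToRingEquiv.toMulEquiv.isField
      (Field.toIsField K)
  let := hK.toField
  -- Étale coordinates: near `x` the curve is étale over a polynomial ring in one variable, a
  -- principal ideal domain.
  obtain ⟨g, -, hg⟩ := hf.exists_etale_mvPolynomial
  algebraize [g]
  have := MvPolynomial.isPrincipalIdealRing_of_unique Γ(Spec (CommRingCat.of K), ⊤) (Fin 1)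
  obtain ⟨h1, h2⟩ := Algebra.Etale.isDomain_and_isPrincipalIdealRing_localization
    (R := MvPolynomial (Fin 1) Γ(Spec (CommRingCat.of K), ⊤)) (hV.primeIdealOf ⟨x, hxV⟩).asIdeal
  let : Algebra Γ(Y, V) (Y.presheaf.stalk x) :=
    TopCat.Presheaf.algebra_section_stalk Y.presheaf (⟨x, hxV⟩ : V)
  have : IsLocalization.AtPrime (Y.presheaf.stalk x) (hV.primeIdealOf ⟨x, hxV⟩).asIdeal :=
    hV.isLocalization_stalk ⟨x, hxV⟩
  let ε : Localization.AtPrime (hV.primeIdealOf ⟨x, hxV⟩).asIdeal ≃ₐ[Γ(Y, V)] Y.presheaf.stalk x :=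
    IsLocalization.algEquiv (hV.primeIdealOf ⟨x, hxV⟩).asIdeal.primeCompl _ _
  exact ⟨ε.toRingEquiv.toMulEquiv.symm.isDomain _,
    IsPrincipalIdealRing.of_surjective ε.toRingEquiv.toRingHom ε.surjective⟩

theorem CSpace.IsAffineCurve.isDomain_and_isPrincipalIdealRing {S : CSpace} (hS : S.IsAffineCurve)
    (x : S.Pt) : IsDomain (S.Ox x) ∧ IsPrincipalIdealRing (S.Ox x) := by
  obtain ⟨Y, f, -, hf, rfl⟩ := hS
  exact SmoothOfRelativeDimension.isDomain_and_isPrincipalIdealRing_stalk f x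

/-! ### Local rings of discs, as germs of analytic functions. -/

namespace DiscStalk

variable {B : Opens ℂ}

/-- The stalk of the sheaf of holomorphic functions. -/
noncomputable abbrev Stalk (x : B) : CommRingCat.{0} :=
  (ChartedSpace.locallyRingedSpace 𝓘(ℂ) B).presheaf.stalk x

/-- The germ `a` is represented by the function `g`. -/
def Rep (x : B) (a : Stalk x) (g : ℂ → ℂ) : Prop :=
  ∃ (U : Opens B) (hx : x ∈ U) (f : C^∞⟮𝓘(ℂ), U; 𝓘(ℂ), ℂ⟯),
    (ChartedSpace.locallyRingedSpace 𝓘(ℂ) B).presheaf.germ U x hx f = a ∧ ∀ y : U, f y = g y.1.1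

theorem contMDiffAt_comp_val_iff {U : Opens B} {y : U} {g : ℂ → ℂ} :
    ContMDiffAt 𝓘(ℂ) 𝓘(ℂ) ∞ (fun z : U => g z.1.1) y ↔ ContDiffAt ℂ ∞ g y.1.1 := by
  rw [← contMDiffAt_iff_contDiffAt]
  exact (contMDiffAt_subtype_iff (U := U) (f := fun z : B => g z.1) (x := y)).trans
    (contMDiffAt_subtype_iff (U := B) (f := g) (x := y.1))

/-- A section is smooth over `ℂ`, so its extension by zero to the plane is complex differentiable on
an open set around `x`, hence analytic at `x`. -/
theorem exists_rep (x : B) (a : Stalk x) : ∃ g, AnalyticAt ℂ g x.1 ∧ Rep x a g := by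
  obtain ⟨(U : Opens B), hx, (f' : C^∞⟮𝓘(ℂ), U; 𝓘(ℂ), ℂ⟯), rfl⟩ :=
    TopCat.Presheaf.exists_germ_eq
    (ChartedSpace.locallyRingedSpace 𝓘(ℂ) B).presheaf a
  let g : ℂ → ℂ := Function.extend (fun z : U => z.1.1) f' 0
  have hg : ∀ y : U, f' y = g y.1.1 := fun y =>
    ((Subtype.val_injective.comp Subtype.val_injective).extend_apply f' 0 y).symm
  refine ⟨g, ?_, U, hx, f', rfl, hg⟩
  have hopen : IsOpen (Set.range fun z : U => z.1.1) := by
    have := (B.isOpenEmbedding'.comp U.isOpenEmbedding').isOpen_range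
    exact this
  refine DifferentiableOn.analyticAt (s := Set.range fun z : U => z.1.1) ?_
    (hopen.mem_nhds ⟨⟨x, hx⟩, rfl⟩)
  rintro _ ⟨y, rfl⟩
  have h1 : ContMDiffAt 𝓘(ℂ) 𝓘(ℂ) ∞ (fun z : U => g z.1.1) y :=
    (f'.contMDiff y).congr_of_eventuallyEq (Filter.Eventually.of_forall fun z => (hg z).symm)
  exact ((contMDiffAt_comp_val_iff.mp h1).differentiableAt (by simp)).differentiableWithinAt

theorem exists_germ_of_analyticAt (x : B) {g : ℂ → ℂ} (hg : AnalyticAt ℂ g x.1) :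
    ∃ a, Rep x a g := by
  obtain ⟨W, hW, hWo, hxW⟩ := eventually_nhds_iff.mp hg.eventually_analyticAt
  let U : Opens B := ⟨Subtype.val ⁻¹' W, hWo.preimage continuous_subtype_val⟩
  refine ⟨_, U, hxW, ⟨fun z => g z.1.1, fun y => ?_⟩, rfl, fun _ => rfl⟩
  exact contMDiffAt_comp_val_iff.mpr (hW _ y.2).contDiffAt

/-- This lets several germs be represented by sections on one common neighbourhood. -/
theorem Rep.res {x : B} {a : Stalk x} {g : ℂ → ℂ} (h : Rep x a g) :
    ∃ (U : Opens B), x ∈ U ∧ ∀ (V : Opens B), V ≤ U → ∀ (hx : x ∈ V),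
      ∃ f : C^∞⟮𝓘(ℂ), V; 𝓘(ℂ), ℂ⟯,
        (ChartedSpace.locallyRingedSpace 𝓘(ℂ) B).presheaf.germ V x hx f = a ∧
        ∀ y : V, f y = g y.1.1 := by
  obtain ⟨U, hx, f, hf, hfg⟩ := h
  refine ⟨U, hx, fun V hV hxV => ⟨ContMDiffMap.restrictRingHom 𝓘(ℂ) 𝓘(ℂ) ℂ hV f, ?_,
    fun y => hfg ⟨y.1, hV y.2⟩⟩⟩
  rw [← hf]
  exact TopCat.Presheaf.germ_res_apply (ChartedSpace.locallyRingedSpace 𝓘(ℂ) B).presheaf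
    (homOfLE hV) x hxV f

theorem Rep.mul {x : B} {a b : Stalk x} {g h : ℂ → ℂ} (ha : Rep x a g) (hb : Rep x b h) :
    Rep x (a * b) (g * h) := by
  obtain ⟨U, hxU, hU⟩ := ha.res
  obtain ⟨V, hxV, hV⟩ := hb.res
  obtain ⟨f, hf, hfg⟩ := hU (U ⊓ V) inf_le_left ⟨hxU, hxV⟩
  obtain ⟨k, hk, hkh⟩ := hV (U ⊓ V) inf_le_right ⟨hxU, hxV⟩
  refine ⟨U ⊓ V, ⟨hxU, hxV⟩, f * k, ?_, fun y => ?_⟩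
  · rw [← hf, ← hk]
    exact map_mul ((ChartedSpace.locallyRingedSpace 𝓘(ℂ) B).presheaf.germ _ x _).hom f k
  · simp [hfg, hkh]

theorem Rep.one (x : B) : Rep x 1 1 :=
  ⟨⊤, trivial, 1, map_one ((ChartedSpace.locallyRingedSpace 𝓘(ℂ) B).presheaf.germ ⊤ x _).hom,
    fun _ => rfl⟩

theorem Rep.zero (x : B) : Rep x 0 0 :=
  ⟨⊤, trivial, 0, map_zero ((ChartedSpace.locallyRingedSpace 𝓘(ℂ) B).presheaf.germ ⊤ x _).hom,
    fun _ => rfl⟩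

theorem Rep.pow {x : B} {a : Stalk x} {g : ℂ → ℂ} (h : Rep x a g) (n : ℕ) :
    Rep x (a ^ n) (g ^ n) := by
  induction n with
  | zero => simpa using Rep.one x
  | succ n ih => rw [pow_succ, pow_succ]; exact ih.mul h

/-- The bridge between stalks and function theory: it turns identities in the stalk into identities
of functions on the plane near `x`. -/
theorem Rep.eq_iff {x : B} {a b : Stalk x} {g h : ℂ → ℂ} (ha : Rep x a g) (hb : Rep x b h) :
    a = b ↔ g =ᶠ[nhds x.1] h := by
  have hn : g =ᶠ[nhds x.1] h ↔ ∀ᶠ y : B in nhds x, g y.1 = h y.1 := by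
    rw [Filter.EventuallyEq, ← map_nhds_subtype_coe_eq_nhds x.2 (B.2.mem_nhds x.2),
      Filter.eventually_map]
  rw [hn]
  constructor
  · rintro rfl
    obtain ⟨U, hxU, f, hf, hfg⟩ := ha
    obtain ⟨V, hxV, k, hk, hkh⟩ := hb
    obtain ⟨(W : Opens B), hxW, i, j, e⟩ := TopCat.Presheaf.germ_eq
      (ChartedSpace.locallyRingedSpace 𝓘(ℂ) B).presheaf x hxU hxV f k (hf.trans hk.symm)
    refine Filter.mem_of_superset (W.2.mem_nhds hxW) fun y hy => ?_
    have e' : f ⟨y, i.le hy⟩ = k ⟨y, j.le hy⟩ :=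
      congrArg (fun s : C^∞⟮𝓘(ℂ), W; 𝓘(ℂ), ℂ⟯ => s ⟨y, hy⟩) e
    rw [hfg, hkh] at e'
    exact e'
  · intro hgh
    obtain ⟨U, hxU, hU⟩ := ha.res
    obtain ⟨V, hxV, hV⟩ := hb.res
    obtain ⟨W, hW, hWo, hxW⟩ := eventually_nhds_iff.mp hgh
    obtain ⟨f, hf, hfg⟩ := hU (U ⊓ V ⊓ ⟨W, hWo⟩) (inf_le_left.trans inf_le_left)
      ⟨⟨hxU, hxV⟩, hxW⟩
    obtain ⟨k, hk, hkh⟩ := hV (U ⊓ V ⊓ ⟨W, hWo⟩) (inf_le_left.trans inf_le_right)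
      ⟨⟨hxU, hxV⟩, hxW⟩
    rw [← hf, ← hk]
    have hfk : f = k := ContMDiffMap.ext fun y => by
      rw [hfg, hkh]
      exact hW y.1 y.2.2
    rw [hfk]

theorem Rep.isUnit {x : B} {a : Stalk x} {g : ℂ → ℂ} (h : Rep x a g) (hg : g x.1 ≠ 0) :
    IsUnit a := by
  obtain ⟨U, hxU, f, rfl, hfg⟩ := h
  refine (smoothSheafCommRing.isUnit_stalk_iff 𝓘(ℂ) _).mpr fun h => hg ?_
  rw [← hfg ⟨x, hxU⟩]
  exact (smoothSheafCommRing.evalHom_germ (IM := 𝓘(ℂ)) (I := 𝓘(ℂ)) (M := B) (R := ℂ) U x hxU f).symm.trans h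

theorem isDomain_and_isPrincipalIdealRing (x : B) :
    IsDomain (Stalk x) ∧ IsPrincipalIdealRing (Stalk x) := by
  obtain ⟨T, hT⟩ := exists_germ_of_analyticAt x (g := fun z => z - x.1)
    (analyticAt_id.sub analyticAt_const)
  have : Nontrivial (Stalk x) :=
    (smoothSheafCommRing.instLocalRing_stalk 𝓘(ℂ) x).toNontrivial
  refine isDomain_and_isPrincipalIdealRing_of_eq_pow_mul T (fun n h0 => ?_) fun a ha => ?_
  · have h1 := ((hT.pow n).eq_iff (Rep.zero x)).mp h0
    -- There are points `z ≠ x` arbitrarily close to `x`, and there `(z - x)^n` is nonzero.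
    obtain ⟨z, hz1, hz2⟩ := ((eventually_mem_nhdsWithin (s := {x.1}ᶜ)).and
      (h1.filter_mono nhdsWithin_le_nhds)).exists
    exact pow_ne_zero n (sub_ne_zero.mpr hz1) hz2
  · obtain ⟨g, hg, hag⟩ := exists_rep x a
    have hne : ¬ ∀ᶠ z in nhds x.1, g z = 0 := fun h => ha ((hag.eq_iff (Rep.zero x)).mpr h)
    -- Here `n` is the order of vanishing of `g` at `x`, and the cofactor `k` becomes the unit.
    obtain ⟨n, k, hk, hk0, he⟩ := hg.exists_eventuallyEq_pow_smul_nonzero_iff.mpr hne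
    obtain ⟨u, hu⟩ := exists_germ_of_analyticAt x hk
    obtain ⟨u, rfl⟩ := hu.isUnit hk0
    exact ⟨n, u, (hag.eq_iff ((hT.pow n).mul hu)).mpr he⟩

end DiscStalk

theorem CSpace.IsDisc.isDomain_and_isPrincipalIdealRing {S : CSpace} (hS : S.IsDisc)
    (x : S.Pt) : IsDomain (S.Ox x) ∧ IsPrincipalIdealRing (S.Ox x) := by
  obtain ⟨c, r, rfl⟩ := hS
  exact DiscStalk.isDomain_and_isPrincipalIdealRing x

/-! ### Sections of free sheaves of modules. -/

noncomputable section

namespace SheafOfModules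

universe u v₁ u₁

variable {C : Type u₁} [Category.{v₁} C] {J : GrothendieckTopology C} {R : Sheaf J RingCat.{u}}
  [HasWeakSheafify J AddCommGrpCat.{u}] [J.WEqualsLocallyBijective AddCommGrpCat.{u}]

/-- The coordinate projections of a free sheaf of modules. -/
def πFree {I : Type u} [DecidableEq I] (i : I) : free (R := R) I ⟶ unit R :=
  Limits.Cofan.IsColimit.desc (isColimitFreeCofan I) fun j => if j = i then 𝟙 _ else 0

theorem ιFree_πFree {I : Type u} [DecidableEq I] (i j : I) :
    ιFree (R := R) j ≫ πFree i = if j = i then 𝟙 _ else 0 :=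
  Limits.Cofan.IsColimit.fac (isColimitFreeCofan I) _ j

theorem free_hom_ext {I : Type u} {M : SheafOfModules.{u} R} {f g : free I ⟶ M}
    (h : ∀ i, ιFree i ≫ f = ιFree i ≫ g) : f = g :=
  Limits.Cofan.IsColimit.hom_ext (isColimitFreeCofan I) _ _ h

theorem sum_πFree_ιFree {I : Type u} [DecidableEq I] [Fintype I] :
    ∑ i, πFree (R := R) i ≫ ιFree i = 𝟙 (free I) := by
  refine free_hom_ext fun j => ?_
  rw [Preadditive.comp_sum, Finset.sum_eq_single j]
  · rw [← Category.assoc, ιFree_πFree, if_pos rfl, Category.id_comp, Category.comp_id]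
  · intro i _ hi
    rw [← Category.assoc, ιFree_πFree, if_neg hi.symm, Limits.zero_comp]
  · simp

/-- The value on an object of the `i`-th tautological section of a free sheaf of modules. -/
def freeElem {I : Type u} (i : I) (X : Cᵒᵖ) : (free (R := R) I).val.obj X :=
  (ιFree i).val.app X (1 : R.obj.obj X)

theorem freeElem_map {I : Type u} (i : I) {X Y : Cᵒᵖ} (f : X ⟶ Y) :
    (free (R := R) I).val.presheaf.map f (freeElem i X) = freeElem i Y := by
  have := PresheafOfModules.naturality_apply (ιFree (R := R) i).val f (1 : R.obj.obj X)
  refine Eq.trans this.symm ?_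
  exact congrArg ((ιFree (R := R) i).val.app Y) (map_one (R.obj.map f).hom)

/-- The free sheaf is a coproduct of sheaves, whose sections are not given by a formula. For finite
`I` the projections `πFree` make it a biproduct, and evaluating them on sections gives the inverse
map. -/
theorem bijective_sum_smul_freeElem {I : Type u} [Fintype I] (X : Cᵒᵖ) :
    Function.Bijective fun c : I → R.obj.obj X =>
      (∑ i, c i • freeElem i X : (free (R := R) I).val.obj X) := by
  classical
  have hι : ∀ (i : I) (r : R.obj.obj X),
      (ιFree (R := R) i).val.app X r = r • freeElem i X := by
    intro i r
    have : r = r • (1 : R.obj.obj X) := by simp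
    conv_lhs => rw [this]
    exact ((ιFree (R := R) i).val.app X).hom.map_smul r (1 : R.obj.obj X)
  have hπ : ∀ i j : I, (πFree (R := R) i).val.app X (freeElem j X) =
      if j = i then (1 : R.obj.obj X) else 0 := by
    intro i j
    have := congrArg (fun φ : unit R ⟶ unit R => φ.val.app X (1 : R.obj.obj X)) (ιFree_πFree i j)
    refine Eq.trans this ?_
    split_ifs <;> rfl
  refine Function.bijective_iff_has_inverse.mpr
    ⟨fun m i => (πFree (R := R) i).val.app X m, fun c => ?_, fun m => ?_⟩
  · funext i
    have h1 := map_sum ((πFree (R := R) i).val.app X).hom (fun j => c j • freeElem j X) Finset.univ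
    refine h1.trans ?_
    rw [Finset.sum_eq_single i]
    · refine (((πFree (R := R) i).val.app X).hom.map_smul (c i) _).trans ?_
      refine (congrArg (fun y => c i • y) (hπ i i)).trans ?_
      rw [if_pos rfl]
      exact mul_one (c i)
    · intro j _ hj
      refine (((πFree (R := R) i).val.app X).hom.map_smul (c j) _).trans ?_
      refine (congrArg (fun y => c j • y) (hπ i j)).trans ?_
      rw [if_neg hj]
      exact mul_zero (c j)
    · simp
  · have h2 := congrArg (fun φ : free (R := R) I ⟶ free I => φ.val.app X m) sum_πFree_ιFree
    refine Eq.trans ?_ h2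
    let ev : (free (R := R) I ⟶ free I) →+ (free (R := R) I).val.obj X :=
      { toFun φ := φ.val.app X m
        map_zero' := rfl
        map_add' _ _ := rfl }
    refine Eq.trans ?_ (map_sum ev (fun i => πFree (R := R) i ≫ ιFree i) Finset.univ).symm
    exact Finset.sum_congr rfl fun i _ => (hι i _).symm

end SheafOfModules
end

/-! ### Local bases, and the passage between stalks and neighbourhoods. -/

noncomputable section

namespace CSpace

variable {S : CSpace}

theorem rs_smul (M : S.Mods) {V U : Opens S.Pt} (h : V ≤ U) (a : S.O U) (m : Sec M U) :
    rs M h (a • m) = S.res h a • rs M h m :=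
  PresheafOfModules.map_smul M.val (homOfLE h).op a m

theorem rs_rs (M : S.Mods) {W V U : Opens S.Pt} (h : V ≤ U) (h' : W ≤ V) (m : Sec M U) :
    rs M h' (rs M h m) = rs M (h'.trans h) m :=
  (ConcreteCategory.congr_hom (M.val.presheaf.map_comp (homOfLE h).op (homOfLE h').op) m).symm

theorem exists_rs_eq_of_mgerm_eq (M : S.Mods) {U : Opens S.Pt} {x : S.Pt} (hx : x ∈ U)
    {m m' : Sec M U} (h : mgerm M hx m = mgerm M hx m') :
    ∃ (V : Opens S.Pt) (_ : x ∈ V) (hV : V ≤ U), rs M hV m = rs M hV m' := by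
  obtain ⟨V, hxV, i, j, e⟩ := TopCat.Presheaf.germ_eq (C := Ab) (X := S.Pt) M.val.presheaf x hx hx
    m m' h
  exact ⟨V, hxV, i.le, e⟩

/-- A finite intersection of open neighbourhoods. -/
theorem exists_nhd_forall_le {ι : Type*} [Finite ι] {x : S.Pt} (U : ι → Opens S.Pt)
    (hU : ∀ i, x ∈ U i) : ∃ V : Opens S.Pt, x ∈ V ∧ ∀ i, V ≤ U i :=
  ⟨⟨⋂ i, U i, isOpen_iInter_of_finite fun i => (U i).2⟩, Set.mem_iInter.mpr hU,
    fun i => Set.iInter_subset (fun i => (U i : Set S.Pt)) i⟩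

/-- The sections `e` over `U` form a basis of the module `M|_U`. -/
def IsBasisOn (M : S.Mods) {U : Opens S.Pt} {n : ℕ} (e : Fin n → Sec M U) : Prop :=
  ∀ (V : Opens S.Pt) (h : V ≤ U),
    Function.Bijective fun c : Fin n → S.O V => ∑ j, c j • rs M h (e j)

namespace IsBasisOn

variable {M : S.Mods} {U : Opens S.Pt} {n : ℕ} {e : Fin n → Sec M U}

theorem restrict (he : IsBasisOn M e) {V : Opens S.Pt} (h : V ≤ U) :
    IsBasisOn M fun j => rs M h (e j) := by
  intro W hW
  simp only [rs_rs]
  exact he W (hW.trans h)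

/-- The coordinates of a section. -/
def coords (he : IsBasisOn M e) (V : Opens S.Pt) (h : V ≤ U) :
    (Fin n → S.O V) ≃ₗ[S.O V] Sec M V :=
  LinearEquiv.ofBijective (Fintype.linearCombination (S.O V) fun j => rs M h (e j)) (he V h)

theorem coords_apply (he : IsBasisOn M e) (V : Opens S.Pt) (h : V ≤ U) (c : Fin n → S.O V) :
    he.coords V h c = ∑ j, c j • rs M h (e j) := rfl

theorem rs_coords (he : IsBasisOn M e) {V W : Opens S.Pt} (h : V ≤ U) (h' : W ≤ V)
    (c : Fin n → S.O V) :
    rs M h' (he.coords V h c) = he.coords W (h'.trans h) fun j => S.res h' (c j) := by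
  rw [coords_apply, coords_apply, map_sum]
  simp only [rs_smul, rs_rs]

theorem mgerm_coords (he : IsBasisOn M e) {V : Opens S.Pt} (h : V ≤ U) {x : S.Pt} (hx : x ∈ V)
    (c : Fin n → S.O V) :
    mgerm M hx (he.coords V h c) = ∑ j, S.germ hx (c j) • mgerm M (h hx) (e j) := by
  rw [coords_apply, map_sum]
  simp only [mgerm_smul, mgerm_res]

/-- The germs of a basis form a basis of the stalk. -/
theorem bijective_stalk (he : IsBasisOn M e) {x : S.Pt} (hx : x ∈ U) :
    Function.Bijective fun c : Fin n → S.Ox x => ∑ j, c j • mgerm M hx (e j) := by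
  have hlift : ∀ c : Fin n → S.Ox x, ∃ (V : Opens S.Pt) (_ : x ∈ V) (_ : V ≤ U)
      (b : Fin n → S.O V), ∀ (hxV : x ∈ V) j, S.germ hxV (b j) = c j := by
    intro c
    have h1 : ∀ j, ∃ (V : Opens S.Pt) (hxV : x ∈ V) (b : S.O V), S.germ hxV b = c j :=
      fun j => TopCat.Presheaf.exists_germ_eq S.X.presheaf (c j)
    choose V hxV b hb using h1
    obtain ⟨W, hxW, hW⟩ := exists_nhd_forall_le V hxV
    refine ⟨W ⊓ U, ⟨hxW, hx⟩, inf_le_right, fun j => S.res (inf_le_left.trans (hW j)) (b j),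
      fun hxV j => ?_⟩
    rw [← hb j]
    exact TopCat.Presheaf.germ_res_apply S.X.presheaf (homOfLE _) x _ _
  constructor
  · have hinj : ∀ c : Fin n → S.Ox x, ∑ j, c j • mgerm M hx (e j) = 0 → c = 0 := by
      intro c hc
      obtain ⟨V, hxV, hV, b, hb⟩ := hlift c
      have h1 : mgerm M hxV (he.coords V hV b) = mgerm M hxV 0 := by
        rw [mgerm_coords, map_zero, ← hc]
        simp only [hb]
      obtain ⟨W, hxW, hW, h2⟩ := exists_rs_eq_of_mgerm_eq M hxV h1
      rw [rs_coords, map_zero, LinearEquiv.map_eq_zero_iff] at h2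
      funext j
      rw [← hb hxV j]
      have h3 : S.res hW (b j) = 0 := congrFun h2 j
      have h4 : S.germ hxW (S.res hW (b j)) = S.germ hxV (b j) :=
        TopCat.Presheaf.germ_res_apply S.X.presheaf (homOfLE hW) x hxW (b j)
      rw [← h4, h3, map_zero]
      rfl
    intro c c' h
    rw [← sub_eq_zero]
    refine hinj _ ?_
    simp only [Pi.sub_apply, sub_smul, Finset.sum_sub_distrib]
    exact sub_eq_zero.mpr h
  · intro s
    obtain ⟨V, hxV, m, rfl⟩ := exists_mgerm M s
    obtain ⟨b, hb⟩ := (he.coords (V ⊓ U) inf_le_right).surjective (rs M inf_le_left m)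
    refine ⟨fun j => S.germ (x := x) (U := V ⊓ U) ⟨hxV, hx⟩ (b j), ?_⟩
    change ∑ j, S.germ (x := x) (U := V ⊓ U) ⟨hxV, hx⟩ (b j) • mgerm M hx (e j) = _
    rw [← mgerm_res M (inf_le_left : V ⊓ U ≤ V) ⟨hxV, hx⟩, ← hb]
    exact (he.mgerm_coords inf_le_right ⟨hxV, hx⟩ b).symm

/-- The coordinates of a germ. -/
def stalkCoords (he : IsBasisOn M e) {x : S.Pt} (hx : x ∈ U) :
    (Fin n → S.Ox x) ≃ₗ[S.Ox x] stalk M x :=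
  LinearEquiv.ofBijective (Fintype.linearCombination (S.Ox x) fun j => mgerm M hx (e j))
    (he.bijective_stalk hx)

end IsBasisOn

/-! ### Morphisms over an open subset -/

/-- The action on sections of a morphism over `U`. -/
def appOver {M T : S.Mods} {U : Opens S.Pt} (φ : M.over U ⟶ T.over U) {V : Opens S.Pt}
    (h : V ≤ U) : Sec M V →ₗ[S.O V] Sec T V :=
  (φ.val.app (op (Over.mk (homOfLE h)))).hom

theorem appOver_rs {M T : S.Mods} {U : Opens S.Pt} (φ : M.over U ⟶ T.over U) {V W : Opens S.Pt}
    (h : V ≤ U) (h' : W ≤ V) (m : Sec M V) :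
    appOver φ (h'.trans h) (rs M h' m) = rs T h' (appOver φ h m) := by
  have := PresheafOfModules.naturality_apply φ.val
    (Over.homMk (homOfLE h') : Over.mk (homOfLE (h'.trans h)) ⟶ Over.mk (homOfLE h)).op m
  exact this

/-- A morphism over `U` from its action on sections. -/
def homOver {M T : S.Mods} {U : Opens S.Pt}
    (φ : ∀ (V : Opens S.Pt), V ≤ U → (Sec M V →ₗ[S.O V] Sec T V))
    (hφ : ∀ (V W : Opens S.Pt) (h : V ≤ U) (h' : W ≤ V) (m : Sec M V),
      φ W (h'.trans h) (rs M h' m) = rs T h' (φ V h m)) : M.over U ⟶ T.over U :=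
  ⟨PresheafOfModules.homMk
    { app V := AddCommGrpCat.ofHom (φ V.unop.left V.unop.hom.le).toAddMonoidHom
      naturality V W f := by
        ext m
        exact hφ V.unop.left W.unop.left V.unop.hom.le f.unop.left.le m }
    (fun V (r : S.O V.unop.left) (m : Sec M V.unop.left) =>
      (φ V.unop.left V.unop.hom.le).map_smul r m)⟩

theorem over_hom_ext {M T : S.Mods} {U : Opens S.Pt} {φ ψ : M.over U ⟶ T.over U}
    (h : ∀ (V : Opens S.Pt) (hV : V ≤ U) (m : Sec M V), appOver φ hV m = appOver ψ hV m) :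
    φ = ψ := by
  refine SheafOfModules.hom_ext (PresheafOfModules.hom_ext fun V => ?_)
  ext m
  exact h V.unop.left V.unop.hom.le m

theorem appOver_comp {M T N : S.Mods} {U : Opens S.Pt} (φ : M.over U ⟶ T.over U)
    (ψ : T.over U ⟶ N.over U) {V : Opens S.Pt} (h : V ≤ U) (m : Sec M V) :
    appOver (φ ≫ ψ) h m = appOver ψ h (appOver φ h m) := rfl

theorem appOver_add {M T : S.Mods} {U : Opens S.Pt} (φ ψ : M.over U ⟶ T.over U) {V : Opens S.Pt}
    (h : V ≤ U) (m : Sec M V) : appOver (φ + ψ) h m = appOver φ h m + appOver ψ h m := rfl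

theorem appOver_zero {M T : S.Mods} {U V : Opens S.Pt} (h : V ≤ U) (m : Sec M V) :
    appOver (0 : M.over U ⟶ T.over U) h m = 0 := rfl

/-- Restriction of a morphism to a smaller open subset. -/
def restrictOver {M T : S.Mods} {U V : Opens S.Pt} (h : V ≤ U) (φ : M.over U ⟶ T.over U) :
    M.over V ⟶ T.over V :=
  homOver (fun _ hW => appOver φ (hW.trans h)) fun _ _ hW h' m => appOver_rs φ (hW.trans h) h' m

theorem appOver_restrictOver {M T : S.Mods} {U V W : Opens S.Pt} (h : V ≤ U)
    (φ : M.over U ⟶ T.over U) (hW : W ≤ V) (m : Sec M W) :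
    appOver (restrictOver h φ) hW m = appOver φ (hW.trans h) m := rfl

/-- The morphism `φ` over `U` induces the map `ψ` on the stalks at `x`. -/
def Induces {M T : S.Mods} {U : Opens S.Pt} {x : S.Pt} (φ : M.over U ⟶ T.over U)
    (ψ : stalk M x →ₗ[S.Ox x] stalk T x) : Prop :=
  ∀ (V : Opens S.Pt) (h : V ≤ U) (hx : x ∈ V) (m : Sec M V),
    ψ (mgerm M hx m) = mgerm T hx (appOver φ h m)

namespace Induces

variable {M T N : S.Mods} {U : Opens S.Pt} {x : S.Pt}

theorem comp {φ : M.over U ⟶ T.over U} {φ' : T.over U ⟶ N.over U}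
    {ψ : stalk M x →ₗ[S.Ox x] stalk T x} {ψ' : stalk T x →ₗ[S.Ox x] stalk N x}
    (h : Induces φ ψ) (h' : Induces φ' ψ') : Induces (φ ≫ φ') (ψ' ∘ₗ ψ) := fun V hV hx m => by
  rw [LinearMap.comp_apply, h V hV, h' V hV, appOver_comp]

theorem add {φ φ' : M.over U ⟶ T.over U} {ψ ψ' : stalk M x →ₗ[S.Ox x] stalk T x}
    (h : Induces φ ψ) (h' : Induces φ' ψ') : Induces (φ + φ') (ψ + ψ') := fun V hV hx m => by
  rw [LinearMap.add_apply, h V hV, h' V hV, appOver_add, map_add]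

theorem id : Induces (𝟙 (M.over U)) (LinearMap.id (R := S.Ox x) (M := stalk M x)) :=
  fun _ _ _ _ => rfl

theorem zero : Induces (0 : M.over U ⟶ T.over U) (0 : stalk M x →ₗ[S.Ox x] stalk T x) :=
  fun _ hV _ m => by rw [appOver_zero hV m, map_zero, LinearMap.zero_apply]

theorem restrict {φ : M.over U ⟶ T.over U} {ψ : stalk M x →ₗ[S.Ox x] stalk T x}
    (h : Induces φ ψ) {V : Opens S.Pt} (hV : V ≤ U) : Induces (restrictOver hV φ) ψ :=
  fun W hW hx m => h W (hW.trans hV) hx m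

end Induces

namespace IsBasisOn

variable {M T : S.Mods} {U : Opens S.Pt} {n : ℕ} {e : Fin n → Sec M U}

/-- The morphism with prescribed values on a basis. -/
def lift (he : IsBasisOn M e) (s : Fin n → Sec T U) : M.over U ⟶ T.over U :=
  homOver (fun V h => Fintype.linearCombination (S.O V) (fun j => rs T h (s j)) ∘ₗ
      (he.coords V h).symm.toLinearMap) fun V W h h' m => by
    obtain ⟨c, rfl⟩ := (he.coords V h).surjective m
    rw [rs_coords]
    simp [Fintype.linearCombination_apply, rs_smul, rs_rs]

theorem appOver_lift_coords (he : IsBasisOn M e) (s : Fin n → Sec T U) {V : Opens S.Pt}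
    (h : V ≤ U) (c : Fin n → S.O V) :
    appOver (he.lift s) h (he.coords V h c) = ∑ j, c j • rs T h (s j) := by
  change Fintype.linearCombination (S.O V) (fun j => rs T h (s j))
      ((he.coords V h).symm (he.coords V h c)) = _
  rw [LinearEquiv.symm_apply_apply, Fintype.linearCombination_apply]

/-- Morphisms that agree on a basis are equal. -/
theorem hom_ext (he : IsBasisOn M e) {φ ψ : M.over U ⟶ T.over U}
    (h : ∀ j, appOver φ le_rfl (e j) = appOver ψ le_rfl (e j)) : φ = ψ := by
  refine over_hom_ext fun V hV m => ?_
  obtain ⟨c, rfl⟩ := (he.coords V hV).surjective m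
  rw [coords_apply, map_sum, map_sum]
  refine Finset.sum_congr rfl fun j _ => ?_
  rw [map_smul, map_smul, appOver_rs φ le_rfl hV, appOver_rs ψ le_rfl hV, h]

/-- Every map of stalks is induced by a morphism over a neighbourhood. -/
theorem exists_induces (he : IsBasisOn M e) {x : S.Pt} (hx : x ∈ U)
    (ψ : stalk M x →ₗ[S.Ox x] stalk T x) :
    ∃ (V : Opens S.Pt) (_ : x ∈ V) (_ : V ≤ U) (φ : M.over V ⟶ T.over V), Induces φ ψ := by
  -- A map out of a finite free module is determined by finitely many germs, which have
  -- representatives on a common neighbourhood.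
  have h1 : ∀ j, ∃ (V : Opens S.Pt) (hxV : x ∈ V) (s : Sec T V),
      mgerm T hxV s = ψ (mgerm M hx (e j)) := fun j => exists_mgerm T _
  choose V hxV s hs using h1
  obtain ⟨W, hxW, hW⟩ := exists_nhd_forall_le V hxV
  refine ⟨W ⊓ U, ⟨hxW, hx⟩, inf_le_right,
    (he.restrict inf_le_right).lift fun j => rs T (inf_le_left.trans (hW j)) (s j),
    fun V hV hxV m => ?_⟩
  obtain ⟨c, rfl⟩ := ((he.restrict inf_le_right).coords V hV).surjective m
  rw [appOver_lift_coords, mgerm_coords, map_sum, map_sum]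
  refine Finset.sum_congr rfl fun j _ => ?_
  rw [map_smul, mgerm_smul, mgerm_res, mgerm_res, mgerm_res, hs]

/-- Morphisms that agree on the stalks agree on a neighbourhood. -/
theorem exists_restrictOver_eq (he : IsBasisOn M e) {x : S.Pt} (hx : x ∈ U)
    {φ φ' : M.over U ⟶ T.over U} {ψ : stalk M x →ₗ[S.Ox x] stalk T x} (h : Induces φ ψ)
    (h' : Induces φ' ψ) :
    ∃ (V : Opens S.Pt) (_ : x ∈ V) (hV : V ≤ U), restrictOver hV φ = restrictOver hV φ' := by
  have h1 : ∀ j, ∃ (V : Opens S.Pt) (_ : x ∈ V) (hV : V ≤ U),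
      rs T hV (appOver φ le_rfl (e j)) = rs T hV (appOver φ' le_rfl (e j)) := fun j =>
    exists_rs_eq_of_mgerm_eq T hx ((h U le_rfl hx _).symm.trans (h' U le_rfl hx _))
  choose V hxV hV hVe using h1
  obtain ⟨W, hxW, hW⟩ := exists_nhd_forall_le V hxV
  refine ⟨W ⊓ U, ⟨hxW, hx⟩, inf_le_right, (he.restrict inf_le_right).hom_ext fun j => ?_⟩
  rw [appOver_restrictOver, appOver_restrictOver, appOver_rs φ le_rfl, appOver_rs φ' le_rfl,
    ← rs_rs T (hV j) (inf_le_left.trans (hW j)), hVe, rs_rs]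

end IsBasisOn

/-! ### Free modules -/

theorem isBasisOn_free (n : ℕ) (U : Opens S.Pt) :
    IsBasisOn (SheafOfModules.free (R := S.ringSheaf) (Fin n))
      fun j => SheafOfModules.freeElem j (op U) := by
  intro V h
  have := SheafOfModules.bijective_sum_smul_freeElem (R := S.ringSheaf) (I := Fin n) (op V)
  have hf : (fun c : Fin n → S.O V => ∑ j, c j • rs (SheafOfModules.free (R := S.ringSheaf) (Fin n))
      h (SheafOfModules.freeElem j (op U))) = fun c : Fin n → S.O V =>
        (∑ j, c j • SheafOfModules.freeElem j (op V) :
          Sec (SheafOfModules.free (R := S.ringSheaf) (Fin n)) V) :=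
    funext fun c => Finset.sum_congr rfl fun j _ =>
      congrArg (fun y : Sec (SheafOfModules.free (R := S.ringSheaf) (Fin n)) V => c j • y)
        (SheafOfModules.freeElem_map j (homOfLE h).op)
  rw [hf]
  exact this

theorem IsVectorBundle.exists_isBasisOn {M : S.Mods} (hM : IsVectorBundle M) (x : S.Pt) :
    ∃ (U : Opens S.Pt) (_ : x ∈ U) (n : ℕ) (e : Fin n → Sec M U), IsBasisOn M e := by
  obtain ⟨U, hx, n, ⟨φ⟩⟩ := hM x
  let ψ (V : Opens S.Pt) (h : V ≤ U) :=
    φ.inv.val.app (op (Over.mk (homOfLE h) : Over U))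
  refine ⟨U, hx, n, fun j => ψ U le_rfl (SheafOfModules.freeElem j _), fun V h => ?_⟩
  have h1 := SheafOfModules.bijective_sum_smul_freeElem (R := S.ringSheaf.over U) (I := Fin n)
    (op (Over.mk (homOfLE h)))
  have h2 : Function.Bijective (ψ V h) := by
    refine Function.bijective_iff_has_inverse.mpr
      ⟨φ.hom.val.app (op (Over.mk (homOfLE h) : Over U)), fun m => ?_, fun m => ?_⟩
    · exact congrArg (fun χ : SheafOfModules.free _ ⟶ SheafOfModules.free _ => χ.val.app _ m)
        φ.inv_hom_id
    · exact congrArg (fun χ : M.over U ⟶ M.over U => χ.val.app _ m) φ.hom_inv_id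
  have h3 : ∀ j, ψ V h (SheafOfModules.freeElem j _) =
      rs M h (ψ U le_rfl (SheafOfModules.freeElem j _)) := by
    intro j
    have := PresheafOfModules.naturality_apply φ.inv.val
      (Over.homMk (homOfLE h) : Over.mk (homOfLE h) ⟶ Over.mk (homOfLE (le_refl U))).op
      (SheafOfModules.freeElem j _)
    refine Eq.trans ?_ this
    exact congrArg (ψ V h) (SheafOfModules.freeElem_map j _).symm
  have hf : (fun c : Fin n → S.O V => ∑ j, c j • rs M h (ψ U le_rfl (SheafOfModules.freeElem j _))) =
      fun c : Fin n → S.O V => (ψ V h (∑ j, (show (S.ringSheaf.over U).obj.obj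
        (op (Over.mk (homOfLE h))) from c j) • SheafOfModules.freeElem j _) : Sec M V) := by
    funext c
    refine Eq.trans ?_ (map_sum (ψ V h).hom (fun j => (show (S.ringSheaf.over U).obj.obj
        (op (Over.mk (homOfLE h))) from c j) • SheafOfModules.freeElem j _) _).symm
    refine Finset.sum_congr rfl fun j _ => ?_
    rw [← h3]
    exact ((ψ V h).hom.map_smul (c j) _).symm
  rw [hf]
  exact h2.comp h1

/-- A module with a basis over `U` is free over `U`. -/
theorem IsBasisOn.nonempty_iso_free {M : S.Mods} {U : Opens S.Pt} {n : ℕ} {e : Fin n → Sec M U}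
    (he : IsBasisOn M e) :
    Nonempty (M.over U ≅ SheafOfModules.free (R := S.ringSheaf.over U) (Fin n)) := by
  let σ : Fin n → (M.over U).sections := fun j => PresheafOfModules.sectionsMk
    (fun V => (rs M V.unop.hom.le (e j) : Sec M V.unop.left)) fun {V W} f =>
      rs_rs M V.unop.hom.le f.unop.left.le (e j)
  let χ : SheafOfModules.free (R := S.ringSheaf.over U) (Fin n) ⟶ M.over U :=
    (SheafOfModules.freeHomEquiv _).symm σ
  have hχ : ∀ (j : Fin n) (V : (Over U)ᵒᵖ), χ.val.app V (SheafOfModules.freeElem j V) =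
      (rs M V.unop.hom.le (e j) : Sec M V.unop.left) := by
    intro j V
    have h := congrFun ((SheafOfModules.freeHomEquiv (M.over U)).apply_symm_apply σ) j
    exact congrArg (fun s : (M.over U).sections => s.eval V) h
  have hbij : ∀ V : (Over U)ᵒᵖ, Function.Bijective (χ.val.app V) := by
    intro V
    have h1 := SheafOfModules.bijective_sum_smul_freeElem (R := S.ringSheaf.over U) (I := Fin n) V
    refine (Function.Bijective.of_comp_iff _ h1).mp ?_
    have h2 := he V.unop.left V.unop.hom.le
    have hf : (χ.val.app V ∘ fun c : Fin n → (S.ringSheaf.over U).obj.obj V =>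
        (∑ j, c j • SheafOfModules.freeElem j V :
          (SheafOfModules.free (R := S.ringSheaf.over U) (Fin n)).val.obj V)) =
        fun c : Fin n → S.O V.unop.left => ∑ j, c j • rs M V.unop.hom.le (e j) := by
      funext c
      refine Eq.trans (map_sum (χ.val.app V).hom
        (fun j => c j • SheafOfModules.freeElem j V) _) ?_
      refine Finset.sum_congr rfl fun j _ => ?_
      rw [← hχ]
      exact (χ.val.app V).hom.map_smul (c j) _
    rw [hf]
    exact h2
  -- Bijectivity on sections over each open subset of `U` suffices, since the forgetful functors to
  -- presheaves of abelian groups reflect isomorphisms.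
  have h1 : IsIso ((PresheafOfModules.toPresheaf _).map χ.val) := by
    rw [NatTrans.isIso_iff_isIso_app]
    intro V
    rw [ConcreteCategory.isIso_iff_bijective]
    exact hbij V
  have h2 : IsIso ((SheafOfModules.forget _).map χ) :=
    isIso_of_reflects_iso χ.val (PresheafOfModules.toPresheaf _)
  have h3 : IsIso χ := isIso_of_reflects_iso χ (SheafOfModules.forget _)
  exact ⟨(asIso χ).symm⟩

end CSpace
end

/-! ### Splitting of the whole complex of stalks, and cycles in the fibre complex. -/

noncomputable section

/-- A complex of finite free modules over a principal ideal domain whose boundaries are saturated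
is homotopy equivalent to a complex of finite free modules with zero differentials. -/
theorem exists_splitting {A : Type*} [CommRing A] [IsDomain A] [IsPrincipalIdealRing A]
    (P : ℤ → Type*) [∀ i, AddCommGroup (P i)] [∀ i, Module A (P i)] [∀ i, Module.Finite A (P i)]
    [∀ i, Module.Free A (P i)] (d : ∀ i j, P i →ₗ[A] P j)
    (hdd : ∀ i j k p, d j k (d i j p) = 0)
    (hsat : ∀ i j, i + 1 = j → ∀ (a : A) (q : P j), a ≠ 0 → a • q ∈ LinearMap.range (d i j) →
      q ∈ LinearMap.range (d i j)) :
    ∃ (n : ℤ → ℕ) (a : ∀ i, (Fin (n i) → A) →ₗ[A] P i) (b : ∀ i, P i →ₗ[A] (Fin (n i) → A))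
      (h : ∀ i j, P i →ₗ[A] P j), (∀ i y, b i (a i y) = y) ∧
      (∀ i k, i + 1 = k → ∀ y, d i k (a i y) = 0) ∧ (∀ i j, j + 1 = i → ∀ p, b i (d j i p) = 0) ∧
      (∀ i j, j + 1 ≠ i → h i j = 0) ∧
      ∀ i j k, j + 1 = i → i + 1 = k → ∀ q, q - a i (b i q) = d j i (h i j q) + h k i (d i k q) := by
  classical
  -- The generalized inverses are fixed for all differentials beforehand, so that the splittings at
  -- neighbouring degrees match: the homotopy in degree `i + 1` agrees with `s` on boundaries, which
  -- is the term needed in degree `i`.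
  have h1 : ∀ i j, i + 1 = j → ∃ s : P j →ₗ[A] P i, ∀ p, d i j (s (d i j p)) = d i j p :=
    fun i j hij => exists_generalized_inverse (d i j) (hsat i j hij)
  choose s hs using h1
  have h2 : ∀ i, ∃ (n : ℕ) (a : (Fin n → A) →ₗ[A] P i) (b : P i →ₗ[A] (Fin n → A)),
      (∀ y, b (a y) = y) ∧ (∀ k, i + 1 = k → ∀ y, d i k (a y) = 0) ∧
      (∀ j, j + 1 = i → ∀ p, b (d j i p) = 0) ∧ ∀ j (hj : j + 1 = i), ∃ h : P i →ₗ[A] P j,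
        (∀ p, h (d j i p) = s j i hj (d j i p)) ∧ ∀ k (hk : i + 1 = k),
          ∀ q, q - a (b q) = d j i (h q) + s i k hk (d i k q) := by
    intro i
    obtain ⟨n, a, b, h, h3, h4, h5, h6, h7⟩ := exists_splitting_at (d (i - 1) i) (d i (i + 1))
      (hdd _ _ _) (hsat _ _ (by omega)) (s (i - 1) i (by omega)) (hs _ _ _) (s i (i + 1) rfl)
      (hs _ _ _)
    refine ⟨n, a, b, h3, ?_, ?_, ?_⟩
    · rintro _ rfl; exact h4
    · intro j hj; obtain rfl : j = i - 1 := by omega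
      exact h5
    · intro j hj; obtain rfl : j = i - 1 := by omega
      refine ⟨h, h6, ?_⟩
      rintro _ rfl; exact h7
  choose n a b hba hda hbd hex using h2
  choose h hh hab using hex
  refine ⟨n, a, b, fun i j => if hj : j + 1 = i then h i j hj else 0, hba, hda, hbd,
    fun i j hij => dif_neg hij, ?_⟩
  intro i j k hj hk q
  simp only [dif_pos hj, dif_pos hk]
  rw [hh, hab i j hj k hk]

namespace HomologicalComplex

/-- The composite of cycles, `φ` and opcycles factors through the map on homology, and an element
that vanishes in the opcycles is a boundary. -/
theorem exists_d_eq_of_homologyMap_eq_zero {A : Type*} [CommRing A] {ι : Type*}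
    {c : ComplexShape ι} {K : HomologicalComplex (ModuleCat.{0} A) c} (φ : K ⟶ K) {i j k : ι}
    (hj : c.prev i = j) (hk : c.next i = k) (h : homologyMap φ i = 0) (z : K.X i)
    (hz : K.d i k z = 0) : ∃ w : K.X j, K.d j i w = φ.f i z := by
  subst hj hk
  let z' : (K.sc i).cycles := (K.sc i).moduleCatCyclesIso.inv ⟨z, hz⟩
  have hz' : (K.sc i).iCycles z' = z :=
    ConcreteCategory.congr_hom (K.sc i).moduleCatCyclesIso_inv_iCycles
      (⟨z, hz⟩ : LinearMap.ker (K.sc i).g.hom)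
  have h1 : K.iCycles i ≫ φ.f i ≫ K.pOpcycles i = 0 := by
    rw [← Category.assoc, ← cyclesMap_i, Category.assoc, ← homology_π_ι, ← Category.assoc,
      ← homologyπ_naturality, h, Limits.comp_zero, Limits.zero_comp]
  have h5 : (K.sc i).pOpcycles (φ.f i z) = 0 := by
    rw [← hz']
    exact ConcreteCategory.congr_hom h1 z'
  exact ((K.sc i).moduleCat_pOpcycles_eq_zero_iff _).mp h5

end HomologicalComplex

/-! ### The logarithmic action on stalks and the saturation of boundaries. -/

namespace CSpace

variable {S : CSpace}

/-- The map on stalks induced by a morphism of sheaves of modules, as a linear map. -/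
def stalkLin {M N : S.Mods} (φ : M ⟶ N) (x : S.Pt) : stalk M x →ₗ[S.Ox x] stalk N x :=
  { stalkMap φ x with map_smul' := stalkMap_smul φ x }

theorem stalkLin_mgerm {M N : S.Mods} (φ : M ⟶ N) {U : Opens S.Pt} {x : S.Pt} (hx : x ∈ U)
    (m : Sec M U) : stalkLin φ x (mgerm M hx m) = mgerm N hx (mapSec φ U m) :=
  stalkMap_germ φ hx m

theorem stalkLin_comp_apply {M N T : S.Mods} (φ : M ⟶ N) (ψ : N ⟶ T) (x : S.Pt) (s : stalk M x) :
    stalkLin ψ x (stalkLin φ x s) = stalkLin (φ ≫ ψ) x s := by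
  obtain ⟨U, hx, m, rfl⟩ := exists_mgerm M s
  rw [stalkLin_mgerm, stalkLin_mgerm, stalkLin_mgerm]
  rfl

theorem stalkLin_zero {M N : S.Mods} (x : S.Pt) (s : stalk M x) :
    stalkLin (0 : M ⟶ N) x s = 0 := by
  obtain ⟨U, hx, m, rfl⟩ := exists_mgerm M s
  rw [stalkLin_mgerm]
  exact map_zero _

theorem induces_over {M N : S.Mods} (φ : M ⟶ N) (U : Opens S.Pt) (x : S.Pt) :
    Induces (x := x) ((SheafOfModules.overFunctor S.ringSheaf U).map φ) (stalkLin φ x) :=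
  fun _ _ hx m => stalkLin_mgerm φ hx m

theorem mem_mSub_iff (M : S.Mods) {x : S.Pt} {t : S.Ox x}
    (ht : IsLocalRing.maximalIdeal (S.Ox x) = Ideal.span {t}) (s : stalk M x) :
    s ∈ mSub M x ↔ ∃ u, s = t • u := by
  rw [mSub, ht, Submodule.ideal_span_singleton_smul, Submodule.mem_smul_pointwise_iff_exists]
  simp [eq_comm]

theorem isUnit_natCast_succ (x : S.Pt) (n : ℕ) : IsUnit ((n + 1 : ℕ) : S.Ox x) := by
  have h : IsUnit ((n + 1 : ℕ) : ℂ) := IsUnit.mk0 _ (Nat.cast_ne_zero.mpr n.succ_ne_zero)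
  have := h.map ((S.germ (U := ⊤) (x := x) trivial).comp S.const)
  rwa [map_natCast] at this

namespace LogAction

variable {x : S.Pt} {F : CochainComplex S.Mods ℤ} (M : LogAction x F)

theorem stalkAct_one (i : ℤ) (s : stalk (F.X i) x) :
    M.stalkAct (U := ⊤) trivial (1 : LogDiffOp x ⊤) i s = stalkLin (M.scalar.f i) x s := by
  obtain ⟨W, hW, m, rfl⟩ := exists_mgerm (F.X i) s
  exact (M.stalkAct_germ (U := ⊤) trivial 1 i hW le_top m).trans
    (stalkLin_mgerm (M.scalar.f i) hW m).symm

theorem stalkAct_d {U : Opens S.Pt} (hx : x ∈ U) (v : LogDiffOp x U) (i j : ℤ)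
    (s : stalk (F.X i) x) :
    M.stalkAct hx v j (stalkLin (F.d i j) x s) = stalkLin (F.d i j) x (M.stalkAct hx v i s) := by
  obtain ⟨W, hW, h, -, m, -, rfl⟩ := exists_germ₂ (F.X i) hx 0 s
  rw [M.stalkAct_germ hx v i hW h, stalkLin_mgerm, stalkLin_mgerm, M.stalkAct_germ hx v j hW h,
    M.act_d]

/-- In the bimodule of operators `v t = t v + t`, because the symbol of `v` takes `t` to `t`; the
action is balanced and left linear. -/
theorem stalkAct_smul_of_isEuler {U : Opens S.Pt} (hx : x ∈ U) {v : LogDiffOp x U} {t : S.O U}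
    (hv : v.IsEuler hx t) (i : ℤ) (s : stalk (F.X i) x) :
    M.stalkAct hx v i (S.germ hx t • s) = S.germ hx t • M.stalkAct hx v i s +
      S.germ hx t • stalkLin (M.scalar.f i) x s := by
  obtain ⟨W, hW, h, -, m, -, rfl⟩ := exists_germ₂ (F.X i) hx 0 s
  have hgt : S.germ hx t = S.germ hW (S.res h t) :=
    (TopCat.Presheaf.germ_res_apply S.X.presheaf (homOfLE h) x hW t).symm
  have hsym : (v.restrict h).symbol (S.res h t) = S.res h t := by
    change v.app W h (S.res h t) - S.res h t * v.app W h 1 = _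
    have h1 := v.app_res le_rfl h t
    have h2 := v.app_res le_rfl h 1
    rw [map_one, hv.2.1, map_zero] at h2
    rw [hv.2.2] at h1
    rw [h1, h2, mul_zero, sub_zero]
  rw [hgt, ← mgerm_smul, M.stalkAct_germ hx v i hW h, M.stalkAct_germ hx v i hW h,
    ← M.act_mulRight, LogDiffOp.mulRight_eq, hsym, M.act_add, M.act_smul, M.act_smul, map_add,
    mgerm_smul, mgerm_smul, stalkLin_mgerm]
  rfl

/-- A cycle modulo `𝔪_x` is mapped to a boundary modulo `𝔪_x` by an endomorphism of the fibre which
is zero on cohomology. -/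
theorem exists_sub_mem_mSub {i j k : ℤ} (hj : j + 1 = i) (hk : i + 1 = k)
    (φ : fibreComplex F x ⟶ fibreComplex F x) (hφ : HomologicalComplex.homologyMap φ i = 0)
    (ψ : stalk (F.X i) x → stalk (F.X i) x)
    (hψ : ∀ s, φ.f i (Submodule.Quotient.mk s) = Submodule.Quotient.mk (ψ s))
    (s : stalk (F.X i) x) (hs : stalkLin (F.d i k) x s ∈ mSub (F.X k) x) :
    ∃ w, ψ s - stalkLin (F.d j i) x w ∈ mSub (F.X i) x := by
  obtain ⟨w, hw⟩ := HomologicalComplex.exists_d_eq_of_homologyMap_eq_zero φ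
    (j := j) (k := k) ((ComplexShape.up ℤ).prev_eq' hj) ((ComplexShape.up ℤ).next_eq' hk) hφ
    (Submodule.Quotient.mk s) ((Submodule.Quotient.mk_eq_zero _).mpr hs)
  obtain ⟨w, rfl⟩ := Submodule.Quotient.mk_surjective _ w
  rw [hψ] at hw
  exact ⟨w, (Submodule.Quotient.eq _).mp hw.symm⟩

theorem exists_scalar_sub_mem_mSub {i j k : ℤ} (hj : j + 1 = i) (hk : i + 1 = k)
    (hMx : HomologicalComplex.homologyMap
      (M.fibreAct (U := ⊤) trivial (1 : LogDiffOp x ⊤)) i = 𝟙 _)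
    (s : stalk (F.X i) x) (hs : stalkLin (F.d i k) x s ∈ mSub (F.X k) x) :
    ∃ w, stalkLin (M.scalar.f i) x s - s - stalkLin (F.d j i) x w ∈ mSub (F.X i) x := by
  -- The operator `1` acts as `M₀`, so the difference with the identity is zero on the cohomology of
  -- the fibre.
  refine exists_sub_mem_mSub hj hk (M.fibreAct (U := ⊤) trivial (1 : LogDiffOp x ⊤) - 𝟙 _) ?_
    (fun s => stalkLin (M.scalar.f i) x s - s) (fun s => ?_) s hs
  · rw [HomologicalComplex.homologyMap_sub, hMx, HomologicalComplex.homologyMap_id, sub_self]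
  · rw [← M.stalkAct_one]
    rfl

theorem exists_iterate_mem_mSub {U : Opens S.Pt} (hx : x ∈ U) (v : LogDiffOp x U) {i : ℤ}
    (hnil : IsNilpotent (End.of (HomologicalComplex.homologyMap (M.fibreAct hx v) i))) :
    ∃ r : ℕ, ∀ {j k : ℤ}, j + 1 = i → i + 1 = k → ∀ s : stalk (F.X i) x,
      stalkLin (F.d i k) x s ∈ mSub (F.X k) x →
      ∃ w, ((M.stalkAct hx v i)^[r]) s - stalkLin (F.d j i) x w ∈ mSub (F.X i) x := by
  obtain ⟨r, hr⟩ := hnil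
  refine ⟨r, fun hj hk s hs => ?_⟩
  let φ : End (fibreComplex F x) := M.fibreAct hx v
  -- Homology is a functor, so nilpotence on cohomology means that a power of the chain map itself
  -- is zero there.
  have h1 : (HomologicalComplex.homologyFunctor (ModuleCat.{0} (S.kx x)) _ i).mapEnd
      (fibreComplex F x) (φ ^ r) = 0 := by
    rw [map_pow]
    exact hr
  refine exists_sub_mem_mSub hj hk (φ ^ r : End (fibreComplex F x)) h1 _ (fun s => ?_) s hs
  clear h1 hr hs
  induction r generalizing s with
  | zero => rfl
  | succ r ih =>
    rw [pow_succ, Function.iterate_succ_apply]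
    exact ih (M.stalkAct hx v i s)

/-- The boundaries of the complex of stalks are saturated. -/
theorem mem_range_of_smul_mem_range [IsDomain (S.Ox x)] [IsPrincipalIdealRing (S.Ox x)]
    [∀ i, Module.Finite (S.Ox x) (stalk (F.X i) x)] [∀ i, Module.Free (S.Ox x) (stalk (F.X i) x)]
    (hMx : ∀ i : ℤ, HomologicalComplex.homologyMap
      (M.fibreAct (U := ⊤) trivial (1 : LogDiffOp x ⊤)) i = 𝟙 _)
    {U : Opens S.Pt} (hx : x ∈ U) {t : S.O U} {v : LogDiffOp x U} (hv : v.IsEuler hx t)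
    (hnil : ∀ i : ℤ, IsNilpotent
      (End.of (HomologicalComplex.homologyMap (M.fibreAct hx v) i)))
    {i j : ℤ} (hij : i + 1 = j) (a : S.Ox x) (q : stalk (F.X j) x) (ha : a ≠ 0)
    (hq : a • q ∈ LinearMap.range (stalkLin (F.d i j) x)) :
    q ∈ LinearMap.range (stalkLin (F.d i j) x) := by
  have ht := hv.1
  -- If the germ of `t` were zero, the local ring would be a field and every submodule saturated.
  -- Otherwise `t` is regular on the free stalks.
  by_cases ht0 : S.germ hx t = 0
  · have hfield : IsField (S.Ox x) := by
      rw [IsLocalRing.isField_iff_maximalIdeal_eq, ht, ht0]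
      simp
    obtain ⟨b, hb⟩ := hfield.mul_inv_cancel ha
    have := Submodule.smul_mem _ b hq
    rwa [smul_smul, mul_comm, hb, one_smul] at this
  · refine mem_of_smul_mem_of_maximalIdeal_eq_span ht (fun q hq => ?_) ha hq
    obtain ⟨p, hp⟩ := hq
    have hdd : ∀ i j k (s : stalk (F.X i) x),
        stalkLin (F.d j k) x (stalkLin (F.d i j) x s) = 0 := fun i j k s => by
      rw [stalkLin_comp_apply, F.d_comp_d, stalkLin_zero]
    obtain ⟨r, hr⟩ := M.exists_iterate_mem_mSub hx v (hnil i)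
    obtain ⟨r', hr'⟩ := M.exists_iterate_mem_mSub hx v (hnil j)
    have htu : ¬ IsUnit (S.germ hx t) := by
      have : S.germ hx t ∈ IsLocalRing.maximalIdeal (S.Ox x) := ht ▸ Ideal.mem_span_singleton_self _
      exact (IsLocalRing.mem_maximalIdeal _).mp this
    have hreg : ∀ k, IsSMulRegular (stalk (F.X k) x) (S.germ hx t) := fun k =>
      (IsRegular.of_ne_zero ht0).isSMulRegular
    have hmem : ∀ (k : ℤ) (s : stalk (F.X k) x), s ∈ mSub (F.X k) x ↔
      ∃ u, s = S.germ hx t • u := fun k s => mem_mSub_iff (F.X k) ht s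
    have hconv : ∀ {k l : ℤ} {s : stalk (F.X k) x}, (∃ w, s - stalkLin (F.d l k) x w ∈
        mSub (F.X k) x) → ∃ u w, s = S.germ hx t • u + stalkLin (F.d l k) x w := by
      rintro k l s ⟨w, hw⟩
      obtain ⟨u, hu⟩ := (hmem _ _).mp hw
      exact ⟨u, w, sub_eq_iff_eq_add.mp hu⟩
    have hMd : ∀ k l (s : stalk (F.X k) x), stalkLin (M.scalar.f l) x (stalkLin (F.d k l) x s) =
        stalkLin (F.d k l) x (stalkLin (M.scalar.f k) x s) := fun k l s => by
      rw [stalkLin_comp_apply, stalkLin_comp_apply, M.scalar.comm]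
    exact _root_.mem_range_of_smul_mem_range (isUnit_natCast_succ x) htu (hreg j) (hreg (j + 1))
      (stalkLin (F.d (i - 1) i) x) (stalkLin (F.d i j) x) (stalkLin (F.d j (j + 1)) x)
      (hdd _ _ _) (hdd _ _ _) (M.stalkAct hx v i) (M.stalkAct hx v j) (M.stalkAct hx v (j + 1))
      (stalkLin (M.scalar.f i) x) (stalkLin (M.scalar.f j) x) (stalkLin (M.scalar.f (j + 1)) x)
      (M.stalkAct_d hx v _ _) (M.stalkAct_d hx v _ _) (hMd _ _) (hMd _ _)
      (M.stalkAct_smul_of_isEuler hx hv j)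
      (fun s hs => hconv (M.exists_scalar_sub_mem_mSub (by omega) hij (hMx i) s ((hmem _ _).mpr hs)))
      (fun s hs => hconv (M.exists_scalar_sub_mem_mSub hij rfl (hMx j) s ((hmem _ _).mpr hs)))
      (fun s hs => hconv (hr (by omega) hij s ((hmem _ _).mpr hs)))
      (fun s hs => hconv (hr' hij rfl s ((hmem _ _).mpr hs))) hp

end LogAction

end CSpace
end

/-! ### Complexes with zero differentials, and spreading out the splitting. -/

noncomputable section

namespace CochainComplex

variable {𝒜 : Type*} [Category 𝒜] [Preadditive 𝒜]

/-- The complex with zero differentials and given terms. -/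
def zeroDifferential (X : ℤ → 𝒜) : CochainComplex 𝒜 ℤ where
  X := X
  d _ _ := 0

/-- The homology of a complex with zero differentials. -/
def zeroDifferentialHomologyIso [CategoryWithHomology 𝒜] (X : ℤ → 𝒜) (i : ℤ) :
    (zeroDifferential X).homology i ≅ X i :=
  (ShortComplex.HomologyData.ofZeros ((zeroDifferential X).sc i) rfl rfl).left.homologyIso

/-- A complex that retracts by deformation onto a graded object with zero differentials. -/
def homotopyEquivZeroDifferential (K : CochainComplex 𝒜 ℤ) (X : ℤ → 𝒜)
    (α : ∀ i, X i ⟶ K.X i) (β : ∀ i, K.X i ⟶ X i) (η : ∀ i j, K.X i ⟶ K.X j)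
    (hη : ∀ i j, j + 1 ≠ i → η i j = 0) (hαβ : ∀ i, α i ≫ β i = 𝟙 _)
    (hα : ∀ i k, i + 1 = k → α i ≫ K.d i k = 0) (hβ : ∀ i j, j + 1 = i → K.d j i ≫ β i = 0)
    (h : ∀ i j k, j + 1 = i → i + 1 = k →
      𝟙 _ = β i ≫ α i + (η i j ≫ K.d j i + K.d i k ≫ η k i)) :
    HomotopyEquiv K (zeroDifferential X) where
  hom :=
    { f := β
      comm' i j hij := ((Limits.comp_zero).trans (hβ j i hij).symm) }
  inv :=
    { f := α
      comm' i j hij := (hα i j hij).trans Limits.zero_comp.symm }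
  homotopyHomInvId := Homotopy.symm
    { hom := η
      zero := fun i j hij => hη i j hij
      comm := fun i => by
        rw [dNext_eq η (show (ComplexShape.up ℤ).Rel i (i + 1) from rfl),
          prevD_eq η (show (ComplexShape.up ℤ).Rel (i - 1) i from sub_add_cancel i 1)]
        refine (h i (i - 1) (i + 1) (by omega) rfl).trans ?_
        change _ = _ + β i ≫ α i
        abel }
  homotopyInvHomId := Homotopy.ofEq (by ext i; exact hαβ i)

/-- Complexes with zero differentials and isomorphic terms are homotopy equivalent. -/
def zeroDifferentialIso {X Y : ℤ → 𝒜} (e : ∀ i, X i ≅ Y i) :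
    zeroDifferential X ≅ zeroDifferential Y :=
  HomologicalComplex.Hom.isoOfComponents e fun _ _ _ =>
    Limits.comp_zero.trans Limits.zero_comp.symm

end CochainComplex

namespace CSpace

variable {S : CSpace}

/-- A family of properties of open subsets, indexed by the integers, that hold near `x` and hold
globally for almost all indices, hold on a common neighbourhood. -/
theorem exists_nhd_forall_int {x : S.Pt} {P : ℤ → Opens S.Pt → Prop}
    (hP : ∀ i (U V : Opens S.Pt), V ≤ U → P i U → P i V) {a b : ℤ}
    (hab : ∀ i, ¬(a ≤ i ∧ i ≤ b) → P i ⊤) (h : ∀ i, ∃ U, x ∈ U ∧ P i U) :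
    ∃ U, x ∈ U ∧ ∀ i, P i U := by
  choose U hxU hU using h
  obtain ⟨V, hxV, hV⟩ := exists_nhd_forall_le (fun i : Finset.Icc a b => U i) fun i => hxU i
  refine ⟨V, hxV, fun i => ?_⟩
  by_cases hi : a ≤ i ∧ i ≤ b
  · exact hP i _ _ (hV ⟨i, Finset.mem_Icc.mpr hi⟩) (hU i)
  · exact hP i _ _ le_top (hab i hi)

theorem subsingleton_sec_of_isZero {M : S.Mods} (hM : Limits.IsZero M) (U : Opens S.Pt) :
    Subsingleton (Sec M U) := by
  refine subsingleton_of_forall_eq 0 fun m => ?_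
  have h : (𝟙 M : M ⟶ M) = 0 := hM.eq_of_src _ _
  exact congrArg (fun φ : M ⟶ M => mapSec φ U m) h

theorem subsingleton_stalk {M : S.Mods} (hM : ∀ U, Subsingleton (Sec M U)) (x : S.Pt) :
    Subsingleton (stalk M x) := by
  refine subsingleton_of_forall_eq 0 fun s => ?_
  obtain ⟨U, hx, m, rfl⟩ := exists_mgerm M s
  rw [Subsingleton.elim m 0, map_zero]

theorem over_hom_ext_of_subsingleton {M T : S.Mods} (hM : ∀ U, Subsingleton (Sec M U))
    {U : Opens S.Pt} (φ ψ : M.over U ⟶ T.over U) : φ = ψ :=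
  over_hom_ext fun V hV m => by rw [Subsingleton.elim m 0, map_zero, map_zero]

theorem induces_zero_of_subsingleton_left {M T : S.Mods} (hM : ∀ U, Subsingleton (Sec M U))
    (U : Opens S.Pt) {x : S.Pt} (ψ : stalk M x →ₗ[S.Ox x] stalk T x) :
    Induces (0 : M.over U ⟶ T.over U) ψ := fun V hV hx m => by
  rw [Subsingleton.elim m 0, map_zero, map_zero, map_zero, map_zero]

theorem isBasisOn_of_subsingleton {M : S.Mods} (hM : ∀ U, Subsingleton (Sec M U))
    (U : Opens S.Pt) : IsBasisOn M (U := U) (n := 0) Fin.elim0 := fun _ _ =>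
  ⟨fun _ _ _ => Subsingleton.elim _ _, fun _ => ⟨0, Subsingleton.elim _ _⟩⟩

/-- Families of morphisms that agree on the stalks at `x` agree on a common neighbourhood. -/
theorem exists_nhd_forall_restrictOver_eq {M T : ℤ → S.Mods} {x : S.Pt} {U : Opens S.Pt}
    (hx : x ∈ U) (hM : ∀ i, ∃ (n : ℕ) (e : Fin n → Sec (M i) U), IsBasisOn (M i) e) {a b : ℤ}
    (hab : ∀ i, ¬(a ≤ i ∧ i ≤ b) → ∀ V, Subsingleton (Sec (M i) V))
    (φ φ' : ∀ i, (M i).over U ⟶ (T i).over U) (ψ : ∀ i, stalk (M i) x →ₗ[S.Ox x] stalk (T i) x)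
    (h : ∀ i, Induces (φ i) (ψ i)) (h' : ∀ i, Induces (φ' i) (ψ i)) :
    ∃ V, x ∈ V ∧ ∀ i (W : Opens S.Pt) (_ : W ≤ V) (hWU : W ≤ U),
      restrictOver hWU (φ i) = restrictOver hWU (φ' i) := by
  refine exists_nhd_forall_int (P := fun i V => ∀ (W : Opens S.Pt) (_ : W ≤ V) (hWU : W ≤ U),
      restrictOver hWU (φ i) = restrictOver hWU (φ' i)) (a := a) (b := b)
    (fun i V V' hV' hV W hW => hV W (hW.trans hV'))
    (fun i hi W _ hWU => over_hom_ext_of_subsingleton (hab i hi) _ _) fun i => ?_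
  obtain ⟨n, e, he⟩ := hM i
  obtain ⟨V, hxV, hV, hVe⟩ := he.exists_restrictOver_eq hx (h i) (h' i)
  exact ⟨V, hxV, fun W hW hWU => congrArg (restrictOver hW) hVe⟩

/-- If the complex of stalks at `x` of a complex of vector bundles has saturated boundaries, then
the complex splits near `x`. -/
theorem splitsNear_of_saturated {x : S.Pt} [IsDomain (S.Ox x)] [IsPrincipalIdealRing (S.Ox x)]
    {F : CochainComplex S.Mods ℤ} (hF : IsBundleComplex F)
    [∀ i, Module.Finite (S.Ox x) (stalk (F.X i) x)] [∀ i, Module.Free (S.Ox x) (stalk (F.X i) x)]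
    (hsat : ∀ i j, i + 1 = j → ∀ (a : S.Ox x) (q : stalk (F.X j) x), a ≠ 0 →
      a • q ∈ LinearMap.range (stalkLin (F.d i j) x) → q ∈ LinearMap.range (stalkLin (F.d i j) x)) :
    SplitsNear F x := by
  obtain ⟨hFb, a₀, b₀, hge, hle⟩ := hF
  have hsub : ∀ i, ¬(a₀ ≤ i ∧ i ≤ b₀) → ∀ V, Subsingleton (Sec (F.X i) V) := by
    intro i hi
    refine subsingleton_sec_of_isZero ?_
    by_cases h1 : a₀ ≤ i
    · exact F.isZero_of_isStrictlyLE b₀ i (by omega)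
    · exact F.isZero_of_isStrictlyGE a₀ i (by omega)
  obtain ⟨n, a, b, h, hba, hda, hbd, hh, hab⟩ := exists_splitting (fun i => stalk (F.X i) x)
    (fun i j => stalkLin (F.d i j) x)
    (fun i j k p => by rw [stalkLin_comp_apply, F.d_comp_d, stalkLin_zero]) hsat
  -- Free sheaves that realize the cohomology of the complex of stalks; `γ` identifies their stalks
  -- at `x` with the modules of the splitting.
  let G : ℤ → S.Mods := fun i => SheafOfModules.free (R := S.ringSheaf) (Fin (n i))
  have hGb : ∀ i (U : Opens S.Pt), IsBasisOn (G i) fun j => SheafOfModules.freeElem j (op U) :=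
    fun i U => isBasisOn_free (n i) U
  let γ : ∀ i, (Fin (n i) → S.Ox x) ≃ₗ[S.Ox x] stalk (G i) x := fun i =>
    (hGb i ⊤).stalkCoords trivial
  -- Where `F` is zero the identity `b a = 1` factors through zero, which forces rank zero. Thus
  -- only finitely many degrees constrain the neighbourhood.
  have hGsub : ∀ i, ¬(a₀ ≤ i ∧ i ≤ b₀) → ∀ V, Subsingleton (Sec (G i) V) := by
    intro i hi V
    have h1 : Subsingleton (stalk (F.X i) x) := subsingleton_stalk (hsub i hi) x
    have h2 : n i = 0 := by
      by_contra hn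
      have : NeZero (n i) := ⟨hn⟩
      have h3 : (1 : Fin (n i) → S.Ox x) = 0 := by
        rw [← hba i 1, Subsingleton.elim (a i 1) 0, map_zero]
      exact one_ne_zero (congrFun h3 0)
    have : IsEmpty (Fin (n i)) := by rw [h2]; infer_instance
    exact ((hGb i ⊤).coords V le_top).symm.injective.subsingleton
  -- a common neighbourhood on which the bundles are trivial
  obtain ⟨U₀, hxU₀, hU₀⟩ : ∃ U, x ∈ U ∧ ∀ i, ∃ (m : ℕ) (e : Fin m → Sec (F.X i) U),
      IsBasisOn (F.X i) e := by
    refine exists_nhd_forall_int (a := a₀) (b := b₀) ?_ ?_ ?_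
    · rintro i U V hVU ⟨m, e, he⟩
      exact ⟨m, _, he.restrict hVU⟩
    · exact fun i hi => ⟨0, _, isBasisOn_of_subsingleton (hsub i hi) ⊤⟩
    · intro i
      obtain ⟨U, hx, m, e, he⟩ := (hFb i).exists_isBasisOn x
      exact ⟨U, hx, m, e, he⟩
  -- a common neighbourhood on which the maps are defined
  obtain ⟨U₁, hxU₁, hα⟩ : ∃ U, x ∈ U ∧ ∀ i, ∃ α : (G i).over U ⟶ (F.X i).over U,
      Induces α (a i ∘ₗ (γ i).symm.toLinearMap) := by
    refine exists_nhd_forall_int (a := a₀) (b := b₀) ?_ ?_ ?_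
    · rintro i U V hVU ⟨α, hα⟩
      exact ⟨_, hα.restrict hVU⟩
    · exact fun i hi => ⟨0, induces_zero_of_subsingleton_left (hGsub i hi) _ _⟩
    · intro i
      obtain ⟨V, hxV, -, α, hα⟩ := (hGb i ⊤).exists_induces trivial
        (a i ∘ₗ (γ i).symm.toLinearMap)
      exact ⟨V, hxV, α, hα⟩
  obtain ⟨U₂, hxU₂, hβ⟩ : ∃ U, x ∈ U ∧ ∀ i, ∃ β : (F.X i).over U ⟶ (G i).over U,
      Induces β ((γ i).toLinearMap ∘ₗ b i) := by
    refine exists_nhd_forall_int (a := a₀) (b := b₀) ?_ ?_ ?_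
    · rintro i U V hVU ⟨α, hα⟩
      exact ⟨_, hα.restrict hVU⟩
    · exact fun i hi => ⟨0, induces_zero_of_subsingleton_left (hsub i hi) _ _⟩
    · intro i
      obtain ⟨m, e, he⟩ := hU₀ i
      obtain ⟨V, hxV, -, β, hβ⟩ := he.exists_induces hxU₀ ((γ i).toLinearMap ∘ₗ b i)
      exact ⟨V, hxV, β, hβ⟩
  obtain ⟨U₃, hxU₃, hη⟩ : ∃ U, x ∈ U ∧ ∀ i, ∃ η : (F.X i).over U ⟶ (F.X (i - 1)).over U,
      Induces η (h i (i - 1)) := by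
    refine exists_nhd_forall_int (a := a₀) (b := b₀) ?_ ?_ ?_
    · rintro i U V hVU ⟨α, hα⟩
      exact ⟨_, hα.restrict hVU⟩
    · exact fun i hi => ⟨0, induces_zero_of_subsingleton_left (hsub i hi) _ _⟩
    · intro i
      obtain ⟨m, e, he⟩ := hU₀ i
      obtain ⟨V, hxV, -, η, hη⟩ := he.exists_induces hxU₀ (h i (i - 1))
      exact ⟨V, hxV, η, hη⟩
  have hη' : ∀ i j, ∃ η : (F.X i).over U₃ ⟶ (F.X j).over U₃,
      Induces η (h i j) ∧ (j + 1 ≠ i → η = 0) := by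
    intro i j
    by_cases hij : j + 1 = i
    · obtain rfl : j = i - 1 := by omega
      obtain ⟨η, hη⟩ := hη i
      exact ⟨η, hη, fun hne => absurd hij hne⟩
    · exact ⟨0, by rw [hh i j hij]; exact Induces.zero, fun _ => rfl⟩
  choose α hα using hα
  choose β hβ using hβ
  choose η hη hη0 using hη'
  let U : Opens S.Pt := U₀ ⊓ (U₁ ⊓ (U₂ ⊓ U₃))
  have hxU : x ∈ U := ⟨hxU₀, hxU₁, hxU₂, hxU₃⟩
  have hUU₀ : U ≤ U₀ := inf_le_left
  have hUU₁ : U ≤ U₁ := inf_le_right.trans inf_le_left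
  have hUU₂ : U ≤ U₂ := inf_le_right.trans (inf_le_right.trans inf_le_left)
  have hUU₃ : U ≤ U₃ := inf_le_right.trans (inf_le_right.trans inf_le_right)
  have hFU : ∀ i, ∃ (m : ℕ) (e : Fin m → Sec (F.X i) U), IsBasisOn (F.X i) e := fun i => by
    obtain ⟨m, e, he⟩ := hU₀ i
    exact ⟨m, _, he.restrict hUU₀⟩
  have hGU : ∀ i, ∃ (m : ℕ) (e : Fin m → Sec (G i) U), IsBasisOn (G i) e := fun i =>
    ⟨_, _, hGb i U⟩
  let D : ∀ i j, (F.X i).over U ⟶ (F.X j).over U := fun i j =>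
    (SheafOfModules.overFunctor S.ringSheaf U).map (F.d i j)
  have hD : ∀ i j, Induces (x := x) (D i j) (stalkLin (F.d i j) x) := fun i j => induces_over _ _ _
  have hα' := fun i => (hα i).restrict hUU₁
  have hβ' := fun i => (hβ i).restrict hUU₂
  have hη' := fun i j => (hη i j).restrict hUU₃
  -- The four identities of a deformation retraction hold on the stalks at `x`; each is extended to
  -- a neighbourhood common to all degrees.
  obtain ⟨V₁, hxV₁, hV₁⟩ := exists_nhd_forall_restrictOver_eq hxU hGU hGsub
    (fun i => restrictOver hUU₁ (α i) ≫ restrictOver hUU₂ (β i)) (fun i => 𝟙 _)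
    (fun i => LinearMap.id) (fun i => by
      convert (hα' i).comp (hβ' i) using 1
      ext s
      simp [hba]) fun i => Induces.id
  obtain ⟨V₂, hxV₂, hV₂⟩ := exists_nhd_forall_restrictOver_eq hxU hGU hGsub
    (fun i => restrictOver hUU₁ (α i) ≫ D i (i + 1)) (fun i => 0)
    (fun i => 0) (fun i => by
      convert (hα' i).comp (hD i (i + 1)) using 1
      ext s
      simp [hda]) fun i => Induces.zero
  obtain ⟨V₃, hxV₃, hV₃⟩ := exists_nhd_forall_restrictOver_eq hxU (fun i => hFU (i - 1))
    -- The range is shifted by one because the source of these maps is the term of degree `i - 1`.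
    (a := a₀ + 1) (b := b₀ + 1) (fun i hi => hsub (i - 1) (by omega))
    (fun i => D (i - 1) i ≫ restrictOver hUU₂ (β i)) (fun i => 0)
    (fun i => 0) (fun i => by
      convert (hD (i - 1) i).comp (hβ' i) using 1
      ext s
      simp [hbd i (i - 1) (by omega)]) fun i => Induces.zero
  obtain ⟨V₄, hxV₄, hV₄⟩ := exists_nhd_forall_restrictOver_eq hxU hFU hsub
    (fun i => 𝟙 _) (fun i => restrictOver hUU₂ (β i) ≫ restrictOver hUU₁ (α i) +
      (restrictOver hUU₃ (η i (i - 1)) ≫ D (i - 1) i + D i (i + 1) ≫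
        restrictOver hUU₃ (η (i + 1) i)))
    (fun i => LinearMap.id) (fun i => Induces.id) fun i => by
      convert ((hβ' i).comp (hα' i)).add (((hη' i (i - 1)).comp (hD (i - 1) i)).add
        ((hD i (i + 1)).comp (hη' (i + 1) i))) using 1
      ext s
      have := hab i (i - 1) (i + 1) (by omega) rfl s
      simp only [LinearMap.id_apply, LinearMap.add_apply, LinearMap.comp_apply,
        LinearEquiv.coe_coe, LinearEquiv.symm_apply_apply]
      rw [← this]
      abel
  let V : Opens S.Pt := U ⊓ (V₁ ⊓ (V₂ ⊓ (V₃ ⊓ V₄)))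
  have hVU : V ≤ U := inf_le_left
  let A i : (G i).over V ⟶ (F.X i).over V := restrictOver (hVU.trans hUU₁) (α i)
  let B i : (F.X i).over V ⟶ (G i).over V := restrictOver (hVU.trans hUU₂) (β i)
  let H i j : (F.X i).over V ⟶ (F.X j).over V := restrictOver (hVU.trans hUU₃) (η i j)
  let e := CochainComplex.homotopyEquivZeroDifferential (restrictComplex F V)
    (fun i => (G i).over V) A B H
    (fun i j hij => by
      change restrictOver _ (η i j) = 0
      rw [hη0 i j hij]; rfl)
    (fun i => hV₁ i V (inf_le_right.trans inf_le_left) hVU)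
    (by
      rintro i _ rfl
      exact hV₂ i V (inf_le_right.trans (inf_le_right.trans inf_le_left)) hVU)
    (by
      intro i j hij
      obtain rfl : j = i - 1 := by omega
      exact hV₃ i V (inf_le_right.trans (inf_le_right.trans (inf_le_right.trans inf_le_left))) hVU)
    (by
      rintro i j _ hij rfl
      obtain rfl : j = i - 1 := by omega
      exact hV₄ i V (inf_le_right.trans (inf_le_right.trans (inf_le_right.trans inf_le_right))) hVU)
  -- The homotopy equivalence itself identifies the cohomology sheaves with the free sheaves, so the
  -- graded target can be replaced by the sum of the cohomology sheaves.
  let ε : ∀ i, (restrictComplex F V).homology i ≅ (G i).over V := fun i =>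
    e.toHomologyIso i ≪≫ CochainComplex.zeroDifferentialHomologyIso _ i
  refine ⟨V, ⟨hxU, hxV₁, hxV₂, hxV₃, hxV₄⟩, ⟨e.trans
    (HomotopyEquiv.ofIso (CochainComplex.zeroDifferentialIso fun i => (ε i).symm))⟩, fun i => ?_⟩
  obtain ⟨φ⟩ := (hGb i V).nonempty_iso_free
  exact ⟨n i, ⟨ε i ≪≫ φ⟩⟩

end CSpace
end

/-! ### The theorem. -/

theorem mainTheorem4 (S : CSpace) (hS : S.IsAffineCurve ∨ S.IsDisc)
    (x : S.Pt) (hx : IsClosed ({x} : Set S.Pt))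
    (F : CochainComplex S.Mods ℤ) (hF : CSpace.IsBundleComplex F)
    (M : CSpace.LogAction x F)
    -- the scalar part of the action is the identity on cohomology sheaves
    (hM : ∀ i : ℤ, HomologicalComplex.homologyMap M.scalar i = 𝟙 (F.homology i))
    -- and on the cohomology of the fibre at `x`
    (hMx : ∀ i : ℤ, HomologicalComplex.homologyMap
      (M.fibreAct (U := ⊤) trivial (1 : CSpace.LogDiffOp x ⊤)) i = 𝟙 _)
    -- a coordinate `t` near `x`, and the vector field `v = t ∂/∂t`
    (U : Opens S.Pt) (hxU : x ∈ U) (t : S.O U) (v : CSpace.LogDiffOp x U) (hv : v.IsEuler hxU t)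
    -- `(t ∂/∂t)_x` acts nilpotently on the cohomology of the fibre at `x`
    (hnil : ∀ i : ℤ, IsNilpotent
      (End.of (HomologicalComplex.homologyMap (M.fibreAct hxU v) i))) :
    CSpace.SplitsNear F x := by
  have hpid : IsDomain (S.Ox x) ∧ IsPrincipalIdealRing (S.Ox x) :=
    hS.elim (fun h => h.isDomain_and_isPrincipalIdealRing x)
      (fun h => h.isDomain_and_isPrincipalIdealRing x)
  have := hpid.1
  have := hpid.2
  have hcoords : ∀ i, ∃ n : ℕ, Nonempty ((Fin n → S.Ox x) ≃ₗ[S.Ox x] CSpace.stalk (F.X i) x) := by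
    intro i
    obtain ⟨V, hxV, n, e, he⟩ := (hF.1 i).exists_isBasisOn x
    exact ⟨n, ⟨he.stalkCoords hxV⟩⟩
  have : ∀ i, Module.Finite (S.Ox x) (CSpace.stalk (F.X i) x) := fun i => by
    obtain ⟨n, ⟨γ⟩⟩ := hcoords i
    exact Module.Finite.equiv γ
  have : ∀ i, Module.Free (S.Ox x) (CSpace.stalk (F.X i) x) := fun i => by
    obtain ⟨n, ⟨γ⟩⟩ := hcoords i
    exact Module.Free.of_equiv γ
  exact CSpace.splitsNear_of_saturated hF fun i j hij a q ha hq =>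
    M.mem_range_of_smul_mem_range hMx hxU hv hnil hij a q ha hq
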